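/- Let $\mathcal G$ be the space of pairs $(V,E)$ where $V\subset\mathbb R^2$ is locally finite and $E\subset V\times V\setminus\{(v,v):v\in V\}$, with the $\sigma$-field generated by the counting functions $(V,E)\mapsto \#(V\cap D)$ and $(V,E)\mapsto\#(E\cap H)$ for bounded Borel sets $D\subset\mathbb R^2$ and $H\subset\mathbb R^2\times\mathbb R^2$. Let $G=(V,E)$ be a random element of $\mathcal G$, defined on a probability space $(\Omega,\mathcal F,\mathbb P)$, whose underlying undirected graph is almost surely acyclic and in which almost surely all vertices have finite degree. Assume: - (Planarity) almost surely, for any two edges $(u,u'),(v,v')\in E$, the segments $[u,u']$ and $[v,v']$, when distinct, can intersect only at a common endpoint; - (Stationarity and ergodicity) there is a measurable, measure-preserving, ergodic action $(\theta_s)_{s\in\mathbb R^2}$ on $\Omega$ such that $G\circ\theta_s=s+G$ for all $s\in\mathbb R^2$, where $s+G$ is the translate of $G$ by $s$; - (Finite edge intensity) $\mathbb E[\#\{(u,v)\in E:[u,v]\cap[0,1]^2\neq\emptyset\}]<\infty$. Assume additionally that, almost surely, $G$ is non-empty, is oriented (if $(v,v')\in E$ then $(v',v)\notin E$), has out-degree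 one (every $v\in V$ has exactly one outgoing edge), and every infinite directed path $(\pi_n)_{n\ge0}$ in $G$ satisfies $\lim_{n\to\infty}\pi_n\cdot e_2=+\infty$, where $e_2=(0,1)$. For a connected component $C$ of the underlying undirected graph, a topological end of $C$ is an equivalence class of infinite undirected simple paths in $C$, two such paths being equivalent if their vertex sets differ by only finitely many vertices; $C$ is $n$-ended if it has exactly $n$ topological ends. Then, almost surely, exactly one of the following holds: - $G$ is a single one-ended tree (it has exactly one connected component, which is a one-ended tree), or - $G$ consists of infinitely many disjoint two-ended trees (it has infinitely many connected components, each of which is a two-ended tree). Moreover, the alternative is deterministic: either the first holds almost surely, or the second holds almost surely. -/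

import Mathlib

open MeasureTheory Filter

/-- The Euclidean plane. -/
abbrev Plane : Type := EuclideanSpace ℝ (Fin 2)

/-- The closed unit square `[0,1]²`. -/
def unitSquare : Set Plane := {x | ∀ i, x i ∈ Set.Icc (0 : ℝ) 1}

/-- The configuration space: pairs `(V, E)` where `V` is a locally finite set of points of the plane
and `E` is a set of directed edges between distinct points of `V`. -/
@[ext]
structure GeomGraph where
  /-- the vertices -/
  V : Set Plane
  /-- the directed edges -/
  E : Set (Plane × Plane)
  locallyFinite : ∀ D : Set Plane, Bornology.IsBounded D → (V ∩ D).Finite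
  edge_mem : ∀ e ∈ E, e.1 ∈ V ∧ e.2 ∈ V
  edge_ne : ∀ e ∈ E, e.1 ≠ e.2

namespace GeomGraph

/-- The σ-field generated by the counting functions `(V, E) ↦ #(V ∩ D)` and `(V, E) ↦ #(E ∩ H)`
for bounded Borel sets `D` and `H`. -/
noncomputable instance instMeasurableSpace : MeasurableSpace GeomGraph :=
  (⨆ D : {D : Set Plane // Bornology.IsBounded D ∧ MeasurableSet D},
      MeasurableSpace.comap (fun g : GeomGraph => (g.V ∩ D.1).encard) ⊤) ⊔
  (⨆ H : {H : Set (Plane × Plane) // Bornology.IsBounded H ∧ MeasurableSet H},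
      MeasurableSpace.comap (fun g : GeomGraph => (g.E ∩ H.1).encard) ⊤)

/-- The translated geometric graph `s + g`: a point `x` is a vertex of `s + g` iff `x - s` is a
vertex of `g`, and similarly for the edges. -/
def translate (s : Plane) (g : GeomGraph) : GeomGraph where
  V := {x | x - s ∈ g.V}
  E := {e | (e.1 - s, e.2 - s) ∈ g.E}
  locallyFinite := by
    intro D hD
    have hb : Bornology.IsBounded ((fun x : Plane => x - s) '' D) :=
      (IsometryEquiv.subRight s).isometry.lipschitz.isBounded_image hD
    refine ((g.locallyFinite _ hb).preimage
      (sub_left_injective (b := s)).injOn).subset ?_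
    rintro x ⟨hx, hxD⟩
    exact ⟨hx, x, hxD, rfl⟩
  edge_mem := fun e he => g.edge_mem _ he
  edge_ne := fun e he h => g.edge_ne _ he (by simp [h])

/-- The underlying undirected graph, on the vertex set `V`: two distinct vertices are adjacent iff
they are joined by an edge in at least one of the two directions. -/
def graph (g : GeomGraph) : SimpleGraph g.V :=
  SimpleGraph.fromRel fun u v => ((u : Plane), (v : Plane)) ∈ g.E

/-- `g` is oriented: no edge occurs together with its reversal. -/
def Oriented (g : GeomGraph) : Prop :=
  ∀ u v : Plane, (u, v) ∈ g.E → (v, u) ∉ g.E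

/-- Every vertex has exactly one outgoing edge. -/
def OutDegreeOne (g : GeomGraph) : Prop :=
  ∀ u ∈ g.V, ∃! v : Plane, (u, v) ∈ g.E

/-- An infinite directed path. -/
def IsDirectedPath (g : GeomGraph) (p : ℕ → Plane) : Prop :=
  ∀ n, (p n, p (n + 1)) ∈ g.E

/-- Non-crossing edges: the segments of two edges, when distinct, meet at most at
a common extremity. -/
def Planar (g : GeomGraph) : Prop :=
  ∀ e ∈ g.E, ∀ f ∈ g.E, segment ℝ e.1 e.2 ≠ segment ℝ f.1 f.2 →
    segment ℝ e.1 e.2 ∩ segment ℝ f.1 f.2 ⊆ {e.1, e.2} ∩ {f.1, f.2}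

/-- The number of edges whose segment meets the unit square. -/
noncomputable def unitSquareEdgeCount (g : GeomGraph) : ℕ∞ :=
  {e ∈ g.E | (segment ℝ e.1 e.2 ∩ unitSquare).Nonempty}.encard

end GeomGraph

namespace SimpleGraph.ConnectedComponent

variable {V : Type*} {G : SimpleGraph V}

/-- An infinite undirected simple path in the connected component `C`. -/
structure SimpleRay (C : G.ConnectedComponent) where
  /-- the successive vertices -/
  path : ℕ → V
  injective : Function.Injective path
  adj : ∀ n, G.Adj (path n) (path (n + 1))
  mem : ∀ n, path n ∈ C.supp

/-- Coalescence: the vertex sets of the two paths differ by only finitely many vertices. -/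
def coalescence (C : G.ConnectedComponent) : Setoid C.SimpleRay where
  r p q := (symmDiff (Set.range p.path) (Set.range q.path)).Finite
  iseqv :=
    { refl := fun p => by simp
      symm := fun {p q} h => by rwa [symmDiff_comm]
      trans := fun {p q r} h₁ h₂ =>
        (h₁.union h₂).subset (symmDiff_triangle _ _ _) }

/-- The number of topological ends of `C`. -/
noncomputable def numEnds (C : G.ConnectedComponent) : ℕ∞ :=
  ENat.card (Quotient C.coalescence)

/-- The component `C` is an `n`-ended tree. -/
def IsEndedTree (C : G.ConnectedComponent) (n : ℕ∞) : Prop :=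
  C.toSimpleGraph.IsTree ∧ C.numEnds = n

end SimpleGraph.ConnectedComponent

namespace GeomGraph

/-- `g` is a single one-ended tree. -/
def IsSingleOneEndedTree (g : GeomGraph) : Prop :=
  ENat.card g.graph.ConnectedComponent = 1 ∧
    ∀ C : g.graph.ConnectedComponent, C.IsEndedTree 1

/-- `g` consists of infinitely many disjoint two-ended trees. -/
def IsInfinitelyManyTwoEndedTrees (g : GeomGraph) : Prop :=
  ENat.card g.graph.ConnectedComponent = ⊤ ∧
    ∀ C : g.graph.ConnectedComponent, C.IsEndedTree 2

end GeomGraph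

/-- A random geometric graph on `(Ω, P)` is stationary and ergodic: there is a (jointly) measurable,
measure-preserving, ergodic action of the translations of the plane on `Ω` for which `G` is
equivariant. -/
def IsStationaryErgodic {Ω : Type*} [MeasurableSpace Ω] (P : Measure Ω) (G : Ω → GeomGraph) :
    Prop :=
  ∃ _ : AddAction Plane Ω, MeasurableVAdd₂ Plane Ω ∧ ErgodicVAdd Plane Ω P ∧
    ∀ (s : Plane) (ω : Ω), G (s +ᵥ ω) = (G ω).translate s

/-- The standing assumptions on the random geometric forest `G`. -/
structure IsPlanarStationaryForest {Ω : Type*} [MeasurableSpace Ω] (P : Measure Ω)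
    (G : Ω → GeomGraph) : Prop where
  measurable : Measurable G
  acyclic : ∀ᵐ ω ∂P, (G ω).graph.IsAcyclic
  finite_degree : ∀ᵐ ω ∂P, ∀ v, ((G ω).graph.neighborSet v).Finite
  planar : ∀ᵐ ω ∂P, (G ω).Planar
  stationary_ergodic : IsStationaryErgodic P G
  finite_edge_intensity : ∫⁻ ω, ((G ω).unitSquareEdgeCount : ENNReal) ∂P < ⊤

/-! Out-degree one turns the forest into the orbit structure of the successor map on arcs: two arcs
lie in one component exactly when their forward orbits merge (`Same`). Since forward orbits climb to
infinity, an orbit starting at or below a level `h` has a last arc with tail at or below `h`, its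
exit, after which it stays strictly above `h`. The classes are studied through the order in which
their exits cross a horizontal line.

Planarity makes the exits of one class an interval among all exits at that level
(`Good.same_of_between`): two merging paths close off a region which a path starting between them
cannot leave without meeting one of them. Horizontal stationarity forbids a class from containing a
proper half-line of exits, so a class which does not own all exits of a level has finitely many
there, hence a rightmost one.

The other engine is mass transport (`ae_bijective_of_transport`): a correspondence between two
equivariant sets of arcs that is onto and single-valued must be bijective when the source has finite
intensity no larger than that of the target. It is used twice. Applied to arcs with ancestors of
every generation, it shows that each of them has only one such predecessor, so a class contains at
most one bi-infinite path. Applied to rightmost exits at levels `h + 1` and `h`, whose intensities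
agree by vertical stationarity, it shows that no class starts between two levels when several
classes exist.

With several classes, each therefore reaches down to all levels while having finitely many exits at
a given one; some exit has arbitrarily low ancestors, and finite degree yields a bi-infinite path,
unique in its class: two ends. Finitely many classes would leave finitely many exits on a line,
against stationarity. With a single class, a bi-infinite path would give exactly one bi-infinite
exit per line that it crosses, again against stationarity: one end. Having a single class is a
translation-invariant event, so ergodicity decides the alternative. -/

/-! ### Planar separation by winding angles -/

section PathSeparation

open Complex Topology

/-- A quotient `-t` with `t ≥ 0` would exhibit `q` as the point of the segment with weights `t / (1
+ t)` and `1 / (1 + t)`. The angle under which a segment is seen is thus continuous off the segment.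
-/
lemma div_mem_slitPlane_of_notMem_segment {a b q : ℂ} (hq : q ∉ segment ℝ a b) :
    (b - q) / (a - q) ∈ slitPlane := by
  have haq : a - q ≠ 0 := fun h => hq (by
    rw [← sub_eq_zero.mp h]; exact left_mem_segment ℝ _ _)
  by_contra hs
  rw [mem_slitPlane_iff, not_or, not_lt, not_not] at hs
  obtain ⟨hre, him⟩ := hs
  set t : ℝ := -((b - q) / (a - q)).re with ht
  have ht0 : 0 ≤ t := by linarith
  have hdiv : (b - q) / (a - q) = ((-t : ℝ) : ℂ) := by
    apply Complex.ext
    · simp [ht]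
    · simpa using him
  rw [div_eq_iff haq] at hdiv
  have h1t : (0 : ℝ) < 1 + t := by linarith
  apply hq
  refine ⟨t / (1 + t), 1 / (1 + t), by positivity, by positivity, by field_simp; ring, ?_⟩
  have h1t' : (1 + t : ℂ) ≠ 0 := by exact_mod_cast h1t.ne'
  simp only [real_smul]
  push_cast at hdiv ⊢
  field_simp
  linear_combination hdiv

/-- Both arguments lie in `[0, π]` and that of the quotient lies strictly between `-π` and `π`, so
the two sides, equal modulo `2π`, differ by less than `2π`. -/
lemma arg_div_sub_eq_sub {a b q : ℂ} (hq : q ∉ segment ℝ a b) (ha : q.im ≤ a.im)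
    (hb : q.im ≤ b.im) : arg ((b - q) / (a - q)) = arg (b - q) - arg (a - q) := by
  have haq : a - q ≠ 0 := fun h => hq (by
    rw [← sub_eq_zero.mp h]; exact left_mem_segment ℝ _ _)
  have hbq : b - q ≠ 0 := fun h => hq (by
    rw [← sub_eq_zero.mp h]; exact right_mem_segment ℝ _ _)
  have h := arg_div_coe_angle hbq haq
  rw [← Real.Angle.coe_sub, Real.Angle.angle_eq_iff_two_pi_dvd_sub] at h
  obtain ⟨k, hk⟩ := h
  have h1 := slitPlane_arg_ne_pi (div_mem_slitPlane_of_notMem_segment hq)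
  have h2 := lt_of_le_of_ne (arg_le_pi ((b - q) / (a - q))) h1
  have h3 := neg_pi_lt_arg ((b - q) / (a - q))
  have h4 := arg_le_pi (b - q)
  have h5 := arg_le_pi (a - q)
  have h6 : 0 ≤ arg (b - q) := arg_nonneg_iff.mpr (by simpa using hb)
  have h7 : 0 ≤ arg (a - q) := arg_nonneg_iff.mpr (by simpa using ha)
  have hpi := Real.pi_pos
  have hk0 : k = 0 := by
    have hlt : (k : ℝ) < 1 := by nlinarith
    have hgt : (-1 : ℝ) < k := by nlinarith
    have : k < 1 := by exact_mod_cast hlt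
    have : -1 < k := by exact_mod_cast hgt
    omega
  rw [hk0] at hk
  push_cast at hk
  linarith

lemma tendsto_arg_div_sub_cobounded (a b : ℂ) :
    Tendsto (fun q : ℂ => arg ((b - q) / (a - q))) (Bornology.cobounded ℂ) (𝓝 0) := by
  have h1 : Tendsto (fun q : ℂ => (b - q) / (a - q)) (Bornology.cobounded ℂ) (𝓝 1) := by
    have hsub : Tendsto (fun q : ℂ => a - q) (Bornology.cobounded ℂ) (Bornology.cobounded ℂ) :=
      tendsto_const_sub_cobounded a
    have h0 : Tendsto (fun q : ℂ => 1 + (b - a) * (a - q)⁻¹) (Bornology.cobounded ℂ)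
        (𝓝 (1 + (b - a) * 0)) :=
      tendsto_const_nhds.add (tendsto_const_nhds.mul (tendsto_inv₀_cobounded.comp hsub))
    rw [mul_zero, add_zero] at h0
    refine h0.congr' ?_
    have hne : ∀ᶠ q : ℂ in Bornology.cobounded ℂ, a - q ≠ 0 := by
      filter_upwards [Bornology.isBounded_def.mp (Bornology.isBounded_singleton (x := a))] with q hq h
      exact hq (sub_eq_zero.mp h).symm
    filter_upwards [hne] with q hq
    field_simp
    ring
  have := (continuousAt_arg (x := 1) (by simp)).tendsto.comp h1
  rwa [arg_one] at this

/-- A polygonal path in a closed half-plane joining two boundary points meets every unbounded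
connected subset of the half-plane which touches the boundary only between these two points. -/
theorem exists_mem_segment_of_isPreconnected_unbounded {N : ℕ} {p : ℕ → ℂ} {y : ℂ} {Q : Set ℂ}
    (hp : ∀ i ≤ N, y.im ≤ (p i).im) (h0 : (p 0).im = y.im) (hN : (p N).im = y.im)
    (h0y : (p 0).re < y.re) (hyN : y.re < (p N).re)
    (hQ : IsPreconnected Q) (hyQ : y ∈ Q) (hQy : ∀ q ∈ Q, q ≠ y → y.im < q.im)
    (hub : ¬ Bornology.IsBounded Q) :
    ∃ i < N, ∃ q ∈ Q, q ∈ segment ℝ (p i) (p (i + 1)) := by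
  by_contra! hdis
  have hoff : ∀ i < N, ∀ q ∈ Q, q ∉ segment ℝ (p i) (p (i + 1)) := hdis
  have hN0 : N ≠ 0 := by rintro rfl; linarith
  have hne : ∀ i ≤ N, ∀ q ∈ Q, p i - q ≠ 0 := by
    intro i hi q hq h
    have h' := sub_eq_zero.mp h
    rcases Nat.lt_or_ge i N with hiN | hiN
    · exact hoff i hiN q hq (h' ▸ left_mem_segment ℝ _ _)
    · have hi1 : i = (N - 1) + 1 := by omega
      exact hoff (N - 1) (by omega) q hq (by rw [← h', hi1]; exact right_mem_segment ℝ _ _)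
  -- `D` compares the angle swept by the path, seen from `q`, with the angle between its endpoints.
  -- It is continuous on `Q` with values in `2πℤ`, hence constant; it tends to `0` at infinity but
  -- equals `-2π` at `y`.
  set D : ℂ → ℝ := fun q => ∑ i ∈ Finset.range N, arg ((p (i + 1) - q) / (p i - q)) -
    arg ((p N - q) / (p 0 - q)) with hD
  have hcont : ContinuousOn D Q := by
    apply ContinuousOn.sub
    · refine continuousOn_finsetSum _ fun i hi => ?_
      have hi' := Finset.mem_range.mp hi
      refine continuousOn_arg.comp ?_ fun q hq =>
        div_mem_slitPlane_of_notMem_segment (hoff i hi' q hq)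
      exact (continuousOn_const.sub continuousOn_id).div (continuousOn_const.sub continuousOn_id)
        (hne i hi'.le)
    · have hc : ContinuousOn (fun q : ℂ => (p N - q) / (p 0 - q)) Q :=
        (continuousOn_const.sub continuousOn_id).div (continuousOn_const.sub continuousOn_id)
        (hne 0 (Nat.zero_le _))
      have him : ∀ q ∈ Q, q ≠ y → 0 < ((p N - q) / (p 0 - q)).im := by
        intro q hq hqy
        have hn : 0 < normSq (p 0 - q) := normSq_pos.mpr (hne 0 (Nat.zero_le _) q hq)
        have hlt := hQy q hq hqy
        rw [div_im, ← sub_div]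
        apply div_pos _ hn
        simp only [sub_im, sub_re, hN, h0]
        nlinarith
      have hyval : ((p N - y) / (p 0 - y)) = (((p N).re - y.re) / ((p 0).re - y.re) : ℝ) := by
        have e1 : p N - y = (((p N).re - y.re : ℝ) : ℂ) := by
          apply Complex.ext <;> simp [hN]
        have e2 : p 0 - y = (((p 0).re - y.re : ℝ) : ℂ) := by
          apply Complex.ext <;> simp [h0]
        rw [e1, e2]; push_cast; rfl
      have hneg : ((p N).re - y.re) / ((p 0).re - y.re) < 0 :=
        div_neg_of_pos_of_neg (by linarith) (by linarith)
      intro q hq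
      by_cases hqy : q = y
      · subst hqy
        -- At `y` the quotient is a negative real, on the cut of `arg`; continuity survives because
        -- on `Q` the quotient stays in the closed upper half-plane.
        have hA : ContinuousWithinAt arg {z : ℂ | 0 ≤ z.im} ((p N - q) / (p 0 - q)) := by
          apply continuousWithinAt_arg_of_re_neg_of_im_zero
          · rw [hyval, ofReal_re]; exact hneg
          · rw [hyval, ofReal_im]
        refine ContinuousWithinAt.comp (f := fun q : ℂ => (p N - q) / (p 0 - q)) hA (hc q hq) ?_
        intro q' hq'
        by_cases h' : q' = q
        · subst h'
          show 0 ≤ ((p N - q') / (p 0 - q')).im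
          rw [hyval, ofReal_im]
        · exact (him q' hq' h').le
      · have hA : ContinuousAt arg ((p N - q) / (p 0 - q)) :=
          continuousAt_arg (mem_slitPlane_iff.mpr (Or.inr (him q hq hqy).ne'))
        exact ContinuousAt.comp_continuousWithinAt
          (f := fun q : ℂ => (p N - q) / (p 0 - q)) hA (hc q hq)
  have hint : ∀ q ∈ Q, ∃ n : ℤ, D q = n * (2 * Real.pi) := by
    intro q hq
    have hang : ((D q : ℝ) : Real.Angle) = 0 := by
      have hsum : ∀ M ≤ N, ((∑ i ∈ Finset.range M, arg ((p (i + 1) - q) / (p i - q)) : ℝ) :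
          Real.Angle) = (arg (p M - q) : Real.Angle) - arg (p 0 - q) := by
        intro M
        induction M with
        | zero => intro _; simp
        | succ M ih =>
          intro hM
          rw [Finset.sum_range_succ, Real.Angle.coe_add, ih (by omega),
            arg_div_coe_angle (hne _ hM q hq) (hne _ (by omega) q hq)]
          abel
      simp only [hD, Real.Angle.coe_sub]
      rw [hsum N le_rfl, arg_div_coe_angle (hne _ le_rfl q hq) (hne _ (Nat.zero_le _) q hq)]
      abel
    obtain ⟨n, hn⟩ := Real.Angle.coe_eq_zero_iff.mp hang
    exact ⟨n, by rw [← hn, zsmul_eq_mul]⟩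
  have hpi := Real.pi_pos
  have hconst : ∀ q ∈ Q, D q = D y := by
    intro q hq
    have hpre := (hQ.image D hcont).ordConnected
    by_contra hqy
    obtain ⟨n, hn⟩ := hint q hq
    obtain ⟨m, hm⟩ := hint y hyQ
    have key : ∀ (k l : ℤ) (a b : ℂ), a ∈ Q → b ∈ Q → D a = k * (2 * Real.pi) →
        D b = l * (2 * Real.pi) → k < l → False := by
      intro k l a b ha hb hk hl hkl
      have hkl' : (k : ℝ) + 1 ≤ l := by exact_mod_cast hkl
      have hmem : (k : ℝ) * (2 * Real.pi) + Real.pi ∈ D '' Q := by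
        apply hpre.out ⟨a, ha, rfl⟩ ⟨b, hb, rfl⟩
        rw [hk, hl]
        constructor <;> nlinarith
      obtain ⟨c, hc, hcD⟩ := hmem
      obtain ⟨j, hj⟩ := hint c hc
      rw [hj] at hcD
      have h2 : (2 * ((j : ℝ) - k) - 1) * Real.pi = 0 := by linarith
      rcases mul_eq_zero.mp h2 with h3 | h3
      · have h4 : (2 * (j - k) - 1 : ℤ) = 0 := by exact_mod_cast h3
        omega
      · exact hpi.ne' h3
    have hnm : n ≠ m := by rintro rfl; exact hqy (hn.trans hm.symm)
    rcases lt_or_gt_of_ne hnm with h | h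
    · exact key n m q y hq hyQ hn hm h
    · exact key m n y q hyQ hq hm hn h
  have hlim : Tendsto D (Bornology.cobounded ℂ ⊓ 𝓟 Q) (𝓝 0) := by
    have : Tendsto D (Bornology.cobounded ℂ) (𝓝 (∑ i ∈ Finset.range N, (0 : ℝ) - 0)) :=
      (tendsto_finsetSum _ fun i _ => tendsto_arg_div_sub_cobounded _ _).sub
        (tendsto_arg_div_sub_cobounded _ _)
    simp only [Finset.sum_const_zero, sub_zero] at this
    exact this.mono_left inf_le_left
  have hnb : (Bornology.cobounded ℂ ⊓ 𝓟 Q).NeBot := by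
    rw [neBot_iff, Ne, inf_principal_eq_bot]
    exact hub
  have hDy0 : D y = 0 := by
    refine tendsto_nhds_unique (f := D) (l := Bornology.cobounded ℂ ⊓ 𝓟 Q) ?_ hlim
    refine tendsto_const_nhds.congr' ?_
    have : ∀ᶠ q in Bornology.cobounded ℂ ⊓ 𝓟 Q, q ∈ Q := mem_inf_of_right (mem_principal_self Q)
    filter_upwards [this] with q hq using (hconst q hq).symm
  -- Seen from `y` the whole path lies in a closed half-plane, so the angles add up without any jump
  -- of `2π`.
  have htel : ∀ M ≤ N, ∑ i ∈ Finset.range M, arg ((p (i + 1) - y) / (p i - y)) =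
      arg (p M - y) - arg (p 0 - y) := by
    intro M
    induction M with
    | zero => intro _; simp
    | succ M ih =>
      intro hM
      rw [Finset.sum_range_succ, ih (by omega), arg_div_sub_eq_sub (hoff M (by omega) y hyQ)
        (hp _ (by omega)) (hp _ hM)]
      abel
  have e1 : p N - y = (((p N).re - y.re : ℝ) : ℂ) := by
    apply Complex.ext <;> simp [hN]
  have e2 : p 0 - y = (((p 0).re - y.re : ℝ) : ℂ) := by
    apply Complex.ext <;> simp [h0]
  have hDy : D y = - Real.pi - Real.pi := by
    simp only [hD]
    rw [htel N le_rfl, e1, e2, ← ofReal_div, arg_ofReal_of_nonneg (by linarith),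
      arg_ofReal_of_neg (by linarith),
      arg_ofReal_of_neg (div_neg_of_pos_of_neg (by linarith) (by linarith))]
    ring
  rw [hDy0] at hDy
  linarith

/-- Two polygonal paths in a closed half-plane which start at boundary points and end at the same
point cannot both avoid an unbounded connected subset of the half-plane which touches the boundary
only between these two points. -/
theorem exists_mem_segment_of_paths {m n : ℕ} {p p' : ℕ → ℂ} {y : ℂ} {Q : Set ℂ}
    (hp : ∀ i, y.im ≤ (p i).im) (hp' : ∀ i, y.im ≤ (p' i).im) (hpp' : p m = p' n)
    (h0 : (p 0).im = y.im) (h0' : (p' 0).im = y.im)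
    (h0y : (p 0).re < y.re) (hyN : y.re < (p' 0).re)
    (hQ : IsPreconnected Q) (hyQ : y ∈ Q) (hQy : ∀ q ∈ Q, q ≠ y → y.im < q.im)
    (hub : ¬ Bornology.IsBounded Q) :
    ∃ q ∈ Q, (∃ i, q ∈ segment ℝ (p i) (p (i + 1))) ∨ ∃ i, q ∈ segment ℝ (p' i) (p' (i + 1)) := by
  -- The first path up to the meeting point, followed by the second one run backwards.
  set c : ℕ → ℂ := fun i => if i ≤ m then p i else p' (m + n - i) with hc
  have hc1 : ∀ i ≤ m, c i = p i := fun i hi => if_pos hi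
  have hc2 : ∀ i, m ≤ i → c i = p' (m + n - i) := by
    intro i hi
    rcases hi.eq_or_lt with rfl | hi
    · rw [hc1 _ le_rfl, hpp']; congr 1; omega
    · exact if_neg (by omega)
  have hcN : c (m + n) = p' 0 := by rw [hc2 _ (by omega)]; simp
  have hc0 : c 0 = p 0 := hc1 0 (Nat.zero_le _)
  obtain ⟨i, hi, q, hq, hqs⟩ := exists_mem_segment_of_isPreconnected_unbounded (N := m + n)
    (p := c) (y := y) (Q := Q)
    (fun i _ => by rcases le_total i m with h | h
                   · rw [hc1 i h]; exact hp i
                   · rw [hc2 i h]; exact hp' _)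
    (by rw [hc0, h0]) (by rw [hcN, h0']) (by rwa [hc0]) (by rwa [hcN]) hQ hyQ hQy hub
  refine ⟨q, hq, ?_⟩
  rcases Nat.lt_or_ge i m with h | h
  · left
    exact ⟨i, by rwa [hc1 i h.le, hc1 (i + 1) h] at hqs⟩
  · right
    refine ⟨m + n - (i + 1), ?_⟩
    rw [hc2 i h, hc2 (i + 1) (by omega), segment_symm] at hqs
    rwa [show m + n - (i + 1) + 1 = m + n - i by omega]

end PathSeparation

/-- A potential directed edge. -/
abbrev Arc : Type := Plane × Plane

/-! ### Measurability of sums and quantifiers over edges -/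

namespace GeomGraph

open ProbabilityTheory

section Measurability

lemma finite_E_inter (g : GeomGraph) {H : Set Arc} (hH : Bornology.IsBounded H) :
    (g.E ∩ H).Finite := by
  refine ((g.locallyFinite _ hH.image_fst).prod (g.locallyFinite _ hH.image_snd)).subset ?_
  rintro e ⟨he, heH⟩
  exact ⟨⟨(g.edge_mem e he).1, e, heH, rfl⟩, ⟨(g.edge_mem e he).2, e, heH, rfl⟩⟩

lemma countable_E (g : GeomGraph) : g.E.Countable := by
  have : g.E = ⋃ n : ℕ, g.E ∩ Metric.ball 0 n := by
    rw [← Set.inter_iUnion, Metric.iUnion_ball_nat, Set.inter_univ]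
  rw [this]
  exact Set.countable_iUnion fun n => (g.finite_E_inter Metric.isBounded_ball).countable

lemma measurableSet_E (g : GeomGraph) : MeasurableSet g.E := g.countable_E.measurableSet

lemma measurable_count_of_isBounded {H : Set Arc} (hH : Bornology.IsBounded H)
    (hm : MeasurableSet H) : Measurable fun g : GeomGraph => Measure.count (g.E ∩ H) := by
  have h1 : (fun g : GeomGraph => (Measure.count (g.E ∩ H) : ENNReal)) =
      (fun n : ℕ∞ => (n : ENNReal)) ∘ fun g : GeomGraph => (g.E ∩ H).encard := by
    funext g
    exact Measure.count_apply (g.measurableSet_E.inter hm)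
  rw [h1, measurable_iff_comap_le, ← MeasurableSpace.comap_comp]
  refine (MeasurableSpace.comap_mono le_top).trans ?_
  exact le_sup_of_le_right (le_iSup_of_le ⟨H, hH, hm⟩ le_rfl)

/-- The annuli `n ≤ ‖e‖ < n + 1`. -/
def annulus (n : ℕ) : Set Arc := {e | ⌊‖e‖⌋₊ = n}

lemma measurableSet_annulus (n : ℕ) : MeasurableSet (annulus n) := by
  have : Measurable fun e : Arc => ⌊‖e‖⌋₊ := Nat.measurable_floor.comp measurable_norm
  exact this (measurableSet_singleton n)

lemma isBounded_annulus (n : ℕ) : Bornology.IsBounded (annulus n) := by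
  refine Metric.isBounded_ball (x := (0 : Arc)) (r := n + 1) |>.subset ?_
  rintro e rfl
  simpa using Nat.lt_floor_add_one ‖e‖

lemma iUnion_annulus : ⋃ n, annulus n = Set.univ :=
  Set.eq_univ_of_forall fun e => Set.mem_iUnion.mpr ⟨⌊‖e‖⌋₊, rfl⟩

lemma disjoint_annulus : Pairwise (Function.onFun Disjoint annulus) := by
  intro m n hmn
  refine Set.disjoint_left.mpr fun e h1 h2 => hmn ?_
  exact h1.symm.trans h2

/-- The part of the counting measure of the edges living in the `p.1`-th annulus, on the event that
there are exactly `p.2` edges there. -/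
noncomputable def annulusKernel (p : ℕ × ℕ) : Kernel GeomGraph Arc where
  toFun g := open scoped Classical in
    if Measure.count (g.E ∩ annulus p.1) = p.2 then
      Measure.count.restrict (g.E ∩ annulus p.1) else 0
  measurable' := by
    classical
    refine Measurable.ite ?_ ?_ measurable_const
    · exact measurable_count_of_isBounded (isBounded_annulus _) (measurableSet_annulus _)
        (measurableSet_singleton _)
    · refine Measure.measurable_of_measurable_coe _ fun H hH => ?_
      have h1 : ∀ g : GeomGraph, Measure.count.restrict (g.E ∩ annulus p.1) H =
          Measure.count (g.E ∩ (annulus p.1 ∩ H)) := by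
        intro g
        rw [Measure.restrict_apply hH, Set.inter_comm, Set.inter_assoc]
      simp only [h1]
      exact measurable_count_of_isBounded ((isBounded_annulus _).subset Set.inter_subset_left)
        ((measurableSet_annulus _).inter hH)

/-- A finite kernel needs a mass bound uniform in the graph, and the number of edges in an annulus
has none. Cutting by the value of this number provides it. -/
instance (p : ℕ × ℕ) : IsFiniteKernel (annulusKernel p) := by
  classical
  refine ⟨⟨p.2, ENNReal.natCast_lt_top _, fun g => ?_⟩⟩
  change (if _ then _ else _ : Measure Arc) _ ≤ _
  split_ifs with h
  · rw [Measure.restrict_apply_univ, h]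
  · simp

/-- The counting measure of the edges of a random graph. -/
noncomputable def arcKernel : Kernel GeomGraph Arc := Kernel.sum annulusKernel

instance : IsSFiniteKernel arcKernel := inferInstanceAs (IsSFiniteKernel (Kernel.sum annulusKernel))

lemma arcKernel_apply (g : GeomGraph) : arcKernel g = Measure.count.restrict g.E := by
  classical
  have h1 : ∀ n, Measure.sum (fun m => annulusKernel (n, m) g) =
      Measure.count.restrict (g.E ∩ annulus n) := by
    intro n
    have hfin := g.finite_E_inter (isBounded_annulus n)
    have hc : Measure.count (g.E ∩ annulus n) = (hfin.toFinset.card : ENNReal) := by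
      conv_lhs => rw [← hfin.coe_toFinset]
      exact Measure.count_apply_finset _
    have h2 : ∀ m, annulusKernel (n, m) g =
        if m = hfin.toFinset.card then Measure.count.restrict (g.E ∩ annulus n) else 0 := by
      intro m
      change (if _ then _ else _ : Measure Arc) = _
      simp only [hc, Nat.cast_inj, eq_comm]
    ext s hs
    rw [Measure.sum_apply _ hs, tsum_eq_single hfin.toFinset.card]
    · rw [h2, if_pos rfl]
    · intro m hm
      rw [h2, if_neg hm]; rfl
  have h3 : arcKernel g = Measure.sum fun n => Measure.sum fun m => annulusKernel (n, m) g := by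
    rw [Measure.sum_sum]
    exact Kernel.sum_apply _ _
  rw [h3]
  simp only [h1]
  rw [← Measure.restrict_iUnion, ← Set.inter_iUnion, iUnion_annulus, Set.inter_univ]
  · exact fun m n hmn => (disjoint_annulus hmn).mono Set.inter_subset_right Set.inter_subset_right
  · exact fun n => g.measurableSet_E.inter (measurableSet_annulus n)

lemma lintegral_arcKernel (g : GeomGraph) (f : Arc → ENNReal) :
    ∫⁻ e, f e ∂(arcKernel g) = ∑' e, g.E.indicator f e := by
  rw [arcKernel_apply, ← lintegral_indicator g.measurableSet_E, lintegral_count]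

variable {X : Type*} [MeasurableSpace X]

/-- Integrals with parameters against an s-finite kernel are measurable, and this sum is such an
integral against `arcKernel`. -/
theorem measurable_tsum_arcs {f : X → Arc → ENNReal} {γ : X → GeomGraph} (hγ : Measurable γ)
    (hf : Measurable (Function.uncurry f)) :
    Measurable fun x => ∑' e, (γ x).E.indicator (f x) e := by
  have h := Measurable.lintegral_kernel_prod_right (κ := arcKernel.comap γ hγ) hf
  simpa only [Kernel.comap_apply, lintegral_arcKernel] using h

/-- An existential over edges says that a sum of indicators is nonzero. All predicates defined below
by quantifying over edges are measurable through this. -/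
theorem measurable_exists_arc {p : X → Arc → Prop} {γ : X → GeomGraph} (hγ : Measurable γ)
    (hp : Measurable (Function.uncurry p)) : Measurable fun x => ∃ e ∈ (γ x).E, p x e := by
  classical
  have hf : Measurable (Function.uncurry fun x e => if p x e then (1 : ENNReal) else 0) :=
    Measurable.ite (measurableSet_setOfPred.mpr hp) measurable_const measurable_const
  have h := measurable_tsum_arcs hγ hf
  have h2 : (fun x => ∃ e ∈ (γ x).E, p x e) =
      fun x => (∑' e, (γ x).E.indicator (fun e => if p x e then (1 : ENNReal) else 0) e) ≠ 0 := by
    funext x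
    simp [ENNReal.tsum_eq_zero]
  rw [h2]
  exact (h.eq measurable_const).not

theorem measurable_forall_arc {p : X → Arc → Prop} {γ : X → GeomGraph} (hγ : Measurable γ)
    (hp : Measurable (Function.uncurry p)) : Measurable fun x => ∀ e ∈ (γ x).E, p x e := by
  have h := (measurable_exists_arc hγ (p := fun x e => ¬ p x e) hp.not).not
  simpa using h

theorem measurable_mem_E {γ : X → GeomGraph} (hγ : Measurable γ) {a : X → Arc}
    (ha : Measurable a) : Measurable fun x => a x ∈ (γ x).E := by
  have h := measurable_exists_arc hγ (p := fun x e => e = a x)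
    (measurableSet_setOfPred.mp (measurableSet_eq_fun measurable_snd (ha.comp measurable_fst)))
  simpa using h

end Measurability

end GeomGraph

/-! ### Predicates on arcs, their measurability and equivariance -/

namespace GeomGraph

/-- `e'` is the `n`-th arc after `e` along some directed path. -/
def Iter (g : GeomGraph) : ℕ → Arc → Arc → Prop
  | 0, e, e' => e = e'
  | n + 1, e, e' => ∃ d ∈ g.E, d.1 = e.2 ∧ Iter g n d e'

/-- `e'` lies on a directed path starting with `e`. -/
def Reach (g : GeomGraph) (e e' : Arc) : Prop := ∃ n, g.Iter n e e'

/-- The arcs `e` and `e'` have directed continuations which merge. -/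
def Same (g : GeomGraph) (e e' : Arc) : Prop := ∃ d ∈ g.E, g.Reach e d ∧ g.Reach e' d

/-- `e` is the last arc, on the directed paths through it, which starts below level `h`. -/
def Exit (g : GeomGraph) (h : ℝ) (e : Arc) : Prop :=
  e ∈ g.E ∧ e.1 1 ≤ h ∧ ∀ d ∈ g.E, g.Reach e d → h < d.2 1

/-- `e` has ancestors of every generation. -/
def Bi (g : GeomGraph) (e : Arc) : Prop := e ∈ g.E ∧ ∀ n, ∃ d ∈ g.E, g.Iter n d e

/-- The abscissa of the point where the line through `e` meets the horizontal line of level `h`. -/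
noncomputable def cross (h : ℝ) (e : Arc) : ℝ :=
  e.1 0 + (h - e.1 1) / (e.2 1 - e.1 1) * (e.2 0 - e.1 0)

/-- `e` is the rightmost exit at level `h` of its class. -/
def Rightmost (g : GeomGraph) (h : ℝ) (e : Arc) : Prop :=
  g.Exit h e ∧ ∀ d ∈ g.E, g.Exit h d → g.Same e d → cross h d ≤ cross h e

section Measurability

variable {X : Type*} [MeasurableSpace X] {γ : X → GeomGraph} {a b : X → Arc}

lemma measurable_iter (n : ℕ) (hγ : Measurable γ) (ha : Measurable a) (hb : Measurable b) :
    Measurable fun x => (γ x).Iter n (a x) (b x) := by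
  induction n generalizing X with
  | zero => exact measurableSet_setOfPred.mp (measurableSet_eq_fun ha hb)
  | succ n ih =>
    refine measurable_exists_arc hγ (Measurable.and ?_ ?_)
    · exact measurableSet_setOfPred.mp
        (measurableSet_eq_fun measurable_snd.fst (ha.comp measurable_fst).snd)
    · exact ih (hγ.comp measurable_fst) measurable_snd (hb.comp measurable_fst)

lemma measurable_reach (hγ : Measurable γ) (ha : Measurable a) (hb : Measurable b) :
    Measurable fun x => (γ x).Reach (a x) (b x) :=
  Measurable.exists fun n => measurable_iter n hγ ha hb

lemma measurable_same (hγ : Measurable γ) (ha : Measurable a) (hb : Measurable b) :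
    Measurable fun x => (γ x).Same (a x) (b x) :=
  measurable_exists_arc hγ
    ((measurable_reach (hγ.comp measurable_fst) (ha.comp measurable_fst) measurable_snd).and
      (measurable_reach (hγ.comp measurable_fst) (hb.comp measurable_fst) measurable_snd))

lemma measurable_coord (i : Fin 2) : Measurable fun x : Plane => x i := by fun_prop

lemma measurable_exit (h : ℝ) (hγ : Measurable γ) (ha : Measurable a) :
    Measurable fun x => (γ x).Exit h (a x) := by
  refine (measurable_mem_E hγ ha).and (Measurable.and ?_ ?_)
  · exact measurableSet_setOfPred.mp
      (measurableSet_le ((measurable_coord 1).comp ha.fst) measurable_const)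
  · refine measurable_forall_arc hγ (Measurable.imp ?_ ?_)
    · exact measurable_reach (hγ.comp measurable_fst) (ha.comp measurable_fst) measurable_snd
    · exact measurableSet_setOfPred.mp
        (measurableSet_lt measurable_const ((measurable_coord 1).comp measurable_snd.snd))

lemma measurable_bi (hγ : Measurable γ) (ha : Measurable a) :
    Measurable fun x => (γ x).Bi (a x) :=
  (measurable_mem_E hγ ha).and <| Measurable.forall fun n => measurable_exists_arc hγ
    (measurable_iter n (hγ.comp measurable_fst) measurable_snd (ha.comp measurable_fst))

lemma measurable_cross (h : ℝ) : Measurable (cross h) := by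
  unfold cross
  fun_prop

lemma measurable_cross_le (h : ℝ) (ha : Measurable a) (hb : Measurable b) :
    Measurable fun x => cross h (a x) ≤ cross h (b x) :=
  measurableSet_setOfPred.mp
    (measurableSet_le ((measurable_cross h).comp ha) ((measurable_cross h).comp hb))

lemma measurable_rightmost (h : ℝ) (hγ : Measurable γ) (ha : Measurable a) :
    Measurable fun x => (γ x).Rightmost h (a x) := by
  refine (measurable_exit h hγ ha).and (measurable_forall_arc hγ (Measurable.imp ?_
    (Measurable.imp ?_ ?_)))
  · exact measurable_exit h (hγ.comp measurable_fst) measurable_snd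
  · exact measurable_same (hγ.comp measurable_fst) (ha.comp measurable_fst) measurable_snd
  · exact measurable_cross_le h measurable_snd (ha.comp measurable_fst)

end Measurability

section Translation

/-- The translation of arcs by `s`. -/
def shiftArc (s : Plane) : Arc ≃ Arc := Equiv.addRight ((s, s) : Arc)

@[simp] lemma shiftArc_fst (s : Plane) (e : Arc) : (shiftArc s e).1 = e.1 + s := rfl

@[simp] lemma shiftArc_snd (s : Plane) (e : Arc) : (shiftArc s e).2 = e.2 + s := rfl

variable (g : GeomGraph) (s : Plane)

@[simp] lemma shiftArc_mem_translate {e : Arc} : shiftArc s e ∈ (g.translate s).E ↔ e ∈ g.E := by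
  simp [translate]

lemma exists_mem_translate {p : Arc → Prop} :
    (∃ e ∈ (g.translate s).E, p e) ↔ ∃ e ∈ g.E, p (shiftArc s e) := by
  rw [(shiftArc s).surjective.exists]
  simp only [shiftArc_mem_translate]

lemma forall_mem_translate {p : Arc → Prop} :
    (∀ e ∈ (g.translate s).E, p e) ↔ ∀ e ∈ g.E, p (shiftArc s e) := by
  rw [(shiftArc s).surjective.forall]
  simp only [shiftArc_mem_translate]

@[simp] lemma iter_translate {n : ℕ} {e d : Arc} :
    (g.translate s).Iter n (shiftArc s e) (shiftArc s d) ↔ g.Iter n e d := by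
  induction n generalizing e with
  | zero => exact (shiftArc s).apply_eq_iff_eq
  | succ n ih => simp only [Iter, exists_mem_translate, ih, shiftArc_fst, shiftArc_snd,
      add_left_inj]

@[simp] lemma reach_translate {e d : Arc} :
    (g.translate s).Reach (shiftArc s e) (shiftArc s d) ↔ g.Reach e d := by
  simp [Reach]

@[simp] lemma same_translate {e d : Arc} :
    (g.translate s).Same (shiftArc s e) (shiftArc s d) ↔ g.Same e d := by
  simp [Same, exists_mem_translate, -Prod.exists]

@[simp] lemma bi_translate {e : Arc} : (g.translate s).Bi (shiftArc s e) ↔ g.Bi e := by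
  simp [Bi, exists_mem_translate, -Prod.exists]

@[simp] lemma exit_translate {h : ℝ} {e : Arc} :
    (g.translate s).Exit (h + s 1) (shiftArc s e) ↔ g.Exit h e := by
  simp [Exit, forall_mem_translate, -Prod.forall]

@[simp] lemma cross_shiftArc (h : ℝ) (e : Arc) :
    cross (h + s 1) (shiftArc s e) = cross h e + s 0 := by
  simp only [cross, shiftArc_fst, shiftArc_snd, PiLp.add_apply]
  rw [show h + s 1 - (e.1 1 + s 1) = h - e.1 1 by ring,
    show e.2 1 + s 1 - (e.1 1 + s 1) = e.2 1 - e.1 1 by ring,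
    show e.2 0 + s 0 - (e.1 0 + s 0) = e.2 0 - e.1 0 by ring]
  ring

@[simp] lemma rightmost_translate {h : ℝ} {e : Arc} :
    (g.translate s).Rightmost (h + s 1) (shiftArc s e) ↔ g.Rightmost h e := by
  simp [Rightmost, forall_mem_translate, -Prod.forall]

end Translation

end GeomGraph

/-! ### The successor map and non-crossing of orbits -/

namespace GeomGraph

/-- The almost sure properties of the random graph. -/
structure Good (g : GeomGraph) : Prop where
  acyclic : g.graph.IsAcyclic
  finite_neighborSet : ∀ v, (g.graph.neighborSet v).Finite
  planar : g.Planar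
  oriented : g.Oriented
  outDegreeOne : g.OutDegreeOne
  nonempty : g.V.Nonempty
  tendsto : ∀ p : ℕ → Plane, g.IsDirectedPath p → Tendsto (fun n => p n 1) atTop atTop
  -- The only condition that is not a hypothesis on the graph: it comes from the finite edge
  -- intensity and makes the exits locally finite along a level.
  finite_cross : ∀ h k : ℤ,
    {e ∈ g.E | e.1 1 ≤ h ∧ (h : ℝ) < e.2 1 ∧ ⌊cross h e⌋ = k}.Finite

/-- The arc following `e`. -/
noncomputable def succ (g : GeomGraph) (e : Arc) : Arc :=
  -- The default value `e` is never taken at an edge of a good graph.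
  open scoped Classical in if h : ∃ d ∈ g.E, d.1 = e.2 then h.choose else e

namespace Good

variable {g : GeomGraph} (hg : g.Good) {e d : Arc}

include hg

lemma eq_of_fst_eq (he : e ∈ g.E) (hd : d ∈ g.E) (h : e.1 = d.1) : e = d := by
  obtain ⟨u, v⟩ := e
  obtain ⟨u', v'⟩ := d
  obtain rfl : u = u' := h
  exact Prod.ext rfl ((hg.outDegreeOne u (g.edge_mem _ he).1).unique he hd)

lemma exists_fst_eq {v : Plane} (hv : v ∈ g.V) : ∃ d ∈ g.E, d.1 = v := by
  obtain ⟨w, hw, -⟩ := hg.outDegreeOne v hv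
  exact ⟨(v, w), hw, rfl⟩

lemma succ_spec (he : e ∈ g.E) : g.succ e ∈ g.E ∧ (g.succ e).1 = e.2 := by
  have h := hg.exists_fst_eq (g.edge_mem e he).2
  rw [succ, dif_pos h]
  exact h.choose_spec

lemma succ_eq_iff (he : e ∈ g.E) (hd : d ∈ g.E) : g.succ e = d ↔ d.1 = e.2 := by
  constructor
  · rintro rfl
    exact (hg.succ_spec he).2
  · intro h
    exact hg.eq_of_fst_eq (hg.succ_spec he).1 hd ((hg.succ_spec he).2.trans h.symm)

lemma iterate_mem (he : e ∈ g.E) (n : ℕ) : g.succ^[n] e ∈ g.E := by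
  induction n with
  | zero => exact he
  | succ n ih => rw [Function.iterate_succ_apply']; exact (hg.succ_spec ih).1

lemma iterate_succ_fst (he : e ∈ g.E) (n : ℕ) : (g.succ^[n + 1] e).1 = (g.succ^[n] e).2 := by
  rw [Function.iterate_succ_apply']
  exact (hg.succ_spec (hg.iterate_mem he n)).2

lemma iter_iff (he : e ∈ g.E) {n : ℕ} : g.Iter n e d ↔ g.succ^[n] e = d := by
  induction n generalizing e with
  | zero => rfl
  | succ n ih =>
    rw [Iter, Function.iterate_succ_apply]
    constructor
    · rintro ⟨c, hc, hce, h⟩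
      rw [(hg.succ_eq_iff he hc).mpr hce]
      exact (ih hc).mp h
    · intro h
      exact ⟨g.succ e, (hg.succ_spec he).1, (hg.succ_spec he).2, (ih (hg.succ_spec he).1).mpr h⟩

lemma reach_iff (he : e ∈ g.E) : g.Reach e d ↔ ∃ n, g.succ^[n] e = d := by
  simp only [Reach, hg.iter_iff he]

lemma same_iff (he : e ∈ g.E) (hd : d ∈ g.E) :
    g.Same e d ↔ ∃ m n, g.succ^[m] e = g.succ^[n] d := by
  simp only [Same, hg.reach_iff he, hg.reach_iff hd]
  constructor
  · rintro ⟨c, -, ⟨m, rfl⟩, ⟨n, h⟩⟩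
    exact ⟨m, n, h.symm⟩
  · rintro ⟨m, n, h⟩
    exact ⟨_, hg.iterate_mem he m, ⟨m, rfl⟩, ⟨n, h.symm⟩⟩

lemma same_refl (he : e ∈ g.E) : g.Same e e := (hg.same_iff he he).mpr ⟨0, 0, rfl⟩

omit hg in
lemma _root_.GeomGraph.Same.symm (h : g.Same e d) : g.Same d e := by
  obtain ⟨c, hc, h1, h2⟩ := h
  exact ⟨c, hc, h2, h1⟩

lemma same_trans {c : Arc} (he : e ∈ g.E) (hd : d ∈ g.E) (hc : c ∈ g.E) (h1 : g.Same e d)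
    (h2 : g.Same d c) : g.Same e c := by
  obtain ⟨m, n, h⟩ := (hg.same_iff he hd).mp h1
  obtain ⟨m', n', h'⟩ := (hg.same_iff hd hc).mp h2
  refine (hg.same_iff he hc).mpr ⟨m' + m, n + n', ?_⟩
  rw [Function.iterate_add_apply, h, ← Function.iterate_add_apply, Function.iterate_add_apply _ n,
    ← h', ← Function.iterate_add_apply, add_comm]

lemma same_iterate (he : e ∈ g.E) (n : ℕ) : g.Same e (g.succ^[n] e) :=
  (hg.same_iff he (hg.iterate_mem he n)).mpr ⟨n, 0, rfl⟩

lemma tendsto_iterate (he : e ∈ g.E) :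
    Tendsto (fun n => (g.succ^[n] e).1 1) atTop atTop := by
  refine hg.tendsto (fun n => (g.succ^[n] e).1) fun n => ?_
  show ((g.succ^[n] e).1, (g.succ^[n + 1] e).1) ∈ g.E
  rw [hg.iterate_succ_fst he]
  exact hg.iterate_mem he n

/-- A repetition would make the forward orbit eventually periodic, whereas its heights tend to
infinity. -/
lemma iterate_injective (he : e ∈ g.E) : Function.Injective fun n => g.succ^[n] e := by
  have key : ∀ m k, g.succ^[m] e = g.succ^[m + (k + 1)] e → False := by
    intro m k h
    set d := g.succ^[m] e with hd
    have hdE : d ∈ g.E := hg.iterate_mem he m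
    have hper : g.succ^[k + 1] d = d := by
      rw [hd, ← Function.iterate_add_apply, add_comm, ← h]
    have hper' : ∀ j, g.succ^[(k + 1) * j] d = d := by
      intro j
      rw [Function.iterate_mul]
      exact Function.iterate_fixed hper j
    have ht := (hg.tendsto_iterate hdE).comp
      (tendsto_id.const_mul_atTop' (r := k + 1) (Nat.succ_pos k))
    simp only [Function.comp_def, id, hper'] at ht
    exact not_tendsto_const_atTop _ _ ht
  intro m n h
  rcases lt_trichotomy m n with hmn | hmn | hmn
  · obtain ⟨k, rfl⟩ := Nat.exists_eq_add_of_lt hmn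
    exact (key m k h).elim
  · exact hmn
  · obtain ⟨k, rfl⟩ := Nat.exists_eq_add_of_lt hmn
    exact (key n k h.symm).elim

lemma exit_iff {h : ℝ} : g.Exit h e ↔ e ∈ g.E ∧ e.1 1 ≤ h ∧ ∀ n, h < (g.succ^[n] e).2 1 := by
  unfold Exit
  refine and_congr_right fun he => and_congr_right fun _ => ?_
  constructor
  · exact fun H n => H _ (hg.iterate_mem he n) ((hg.reach_iff he).mpr ⟨n, rfl⟩)
  · intro H d hd hr
    obtain ⟨n, rfl⟩ := (hg.reach_iff he).mp hr
    exact H n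

/-- Only finitely many tails on the orbit lie at or below `h`; the last of these arcs is the exit,
since the head of an arc is the tail of the next. -/
lemma exists_exit {h : ℝ} (he : e ∈ g.E) (hh : e.1 1 ≤ h) :
    ∃ n, g.Exit h (g.succ^[n] e) := by
  have hfin : {n | (g.succ^[n] e).1 1 ≤ h}.Finite := by
    have := (hg.tendsto_iterate he).eventually (eventually_gt_atTop h)
    rw [← Nat.cofinite_eq_atTop, eventually_cofinite] at this
    simpa using this
  obtain ⟨n, hn, hmax⟩ := Set.exists_max_image _ id hfin ⟨0, hh⟩
  refine ⟨n, hg.exit_iff.mpr ⟨hg.iterate_mem he n, hn, fun k => ?_⟩⟩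
  by_contra! hlt
  rw [← Function.iterate_add_apply, ← hg.iterate_succ_fst he] at hlt
  have := hmax _ hlt
  simp only [id] at this
  omega

lemma finite_pred (v : Plane) : {c ∈ g.E | c.2 = v}.Finite := by
  by_cases hv : v ∈ g.V
  · refine ((hg.finite_neighborSet ⟨v, hv⟩).image fun w : g.V => ((w : Plane), v)).subset ?_
    rintro ⟨u, w⟩ ⟨hc, rfl⟩
    refine ⟨⟨u, (g.edge_mem _ hc).1⟩, ?_, rfl⟩
    rw [SimpleGraph.mem_neighborSet, graph, SimpleGraph.fromRel_adj]
    refine ⟨fun h => g.edge_ne _ hc (congrArg Subtype.val h).symm, Or.inr hc⟩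
  · refine Set.finite_empty.subset ?_
    rintro c ⟨hc, rfl⟩
    exact hv (g.edge_mem _ hc).2

end Good

section Segments

/-- An endpoint of a segment is an extreme point of it. -/
lemma mem_pair_of_segment_eq {a b c d : Plane} (hab : a ≠ b)
    (h : segment ℝ a b = segment ℝ c d) : a = c ∨ a = d := by
  have ha : a ∈ segment ℝ c d := h ▸ left_mem_segment ℝ a b
  have hc : c ∈ segment ℝ a b := h ▸ left_mem_segment ℝ c d
  have hd : d ∈ segment ℝ a b := h ▸ right_mem_segment ℝ c d
  obtain ⟨u, v, hu, hv, huv, ha⟩ := ha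
  obtain ⟨s', s, hs', hs, hss, rfl⟩ := hc
  obtain ⟨t', t, ht', ht, htt, rfl⟩ := hd
  obtain rfl : s' = 1 - s := by linarith
  obtain rfl : t' = 1 - t := by linarith
  obtain rfl : u = 1 - v := by linarith
  have h0 : ((1 - v) * s + v * t) • (b - a) = 0 := by
    have e : (1 - v) • ((1 - s) • a + s • b) + v • ((1 - t) • a + t • b) =
      a + ((1 - v) * s + v * t) • (b - a) := by module
    rw [e] at ha
    simpa using ha
  have h1 : (1 - v) * s + v * t = 0 :=
    (smul_eq_zero.mp h0).resolve_right (sub_ne_zero.mpr hab.symm)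
  have h2 : (1 - v) * s = 0 := by nlinarith [mul_nonneg hu hs, mul_nonneg hv ht]
  have h3 : v * t = 0 := by linarith
  rcases mul_eq_zero.mp h2 with h4 | h4
  · right
    have : t = 0 := by
      rcases mul_eq_zero.mp h3 with h5 | h5
      · linarith
      · exact h5
    simp [this]
  · left
    simp [h4]

variable {g : GeomGraph} (hg : g.Good) {e d : Arc}

include hg

/-- Planarity says nothing about arcs with the same segment. Equal tails are settled by out-degree
one, and reversed arcs are excluded by orientation. -/
lemma Good.eq_of_segment_eq (he : e ∈ g.E) (hd : d ∈ g.E)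
    (h : segment ℝ e.1 e.2 = segment ℝ d.1 d.2) : e = d := by
  have hne := g.edge_ne e he
  rcases mem_pair_of_segment_eq hne h with h1 | h1
  · exact hg.eq_of_fst_eq he hd h1
  · rw [segment_symm] at h
    rcases mem_pair_of_segment_eq hne.symm h with h2 | h2
    · exfalso
      apply hg.oriented e.1 e.2 he
      rw [h1, h2]
      exact hd
    · exact absurd (h1.trans h2.symm) hne

/-- By planarity distinct segments can only share an endpoint; whichever endpoints coincide, the
forward orbits agree after at most one step each. -/
lemma Good.same_of_mem_segment (he : e ∈ g.E) (hd : d ∈ g.E) {x : Plane}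
    (hxe : x ∈ segment ℝ e.1 e.2) (hxd : x ∈ segment ℝ d.1 d.2) : g.Same e d := by
  by_cases h : segment ℝ e.1 e.2 = segment ℝ d.1 d.2
  · rw [hg.eq_of_segment_eq he hd h]
    exact hg.same_refl hd
  · rw [hg.same_iff he hd]
    obtain ⟨h1 | h1, h2 | h2⟩ := hg.planar e he d hd h ⟨hxe, hxd⟩
    · exact ⟨0, 0, hg.eq_of_fst_eq he hd (h1.symm.trans h2)⟩
    · exact ⟨0, 1, ((hg.succ_eq_iff hd he).mpr (h1.symm.trans h2)).symm⟩
    · exact ⟨1, 0, (hg.succ_eq_iff he hd).mpr (h2.symm.trans h1)⟩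
    · refine ⟨1, 1, (hg.succ_eq_iff he (hg.succ_spec hd).1).mpr ?_⟩
      rw [(hg.succ_spec hd).2]
      exact h2.symm.trans h1

/-- The point of level `h` with abscissa `cross h e`. -/
noncomputable def crossPoint (h : ℝ) (e : Arc) : Plane := !₂[cross h e, h]

omit hg in
@[simp] lemma crossPoint_zero (h : ℝ) (e : Arc) : crossPoint h e 0 = cross h e := rfl

omit hg in
@[simp] lemma crossPoint_one (h : ℝ) (e : Arc) : crossPoint h e 1 = h := rfl

omit hg in
lemma crossPoint_mem_segment {h : ℝ} (h1 : e.1 1 ≤ h) (h2 : h < e.2 1) :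
    crossPoint h e ∈ segment ℝ e.1 e.2 := by
  have hpos : 0 < e.2 1 - e.1 1 := by linarith
  refine ⟨1 - (h - e.1 1) / (e.2 1 - e.1 1), (h - e.1 1) / (e.2 1 - e.1 1), ?_, ?_, by ring, ?_⟩
  · rw [sub_nonneg, div_le_one hpos]; linarith
  · exact div_nonneg (by linarith) hpos.le
  · ext i
    fin_cases i
    · simp [cross]; ring
    · simp; field_simp; ring

/-- A common crossing point of distinct segments would be an endpoint of both arcs. The heads lie
strictly above the level, so it would be the common tail, and out-degree one concludes. -/
lemma Good.eq_of_cross_eq {h : ℝ} (he : g.Exit h e) (hd : g.Exit h d)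
    (hx : cross h e = cross h d) : e = d := by
  obtain ⟨heE, he1, he2⟩ := hg.exit_iff.mp he
  obtain ⟨hdE, hd1, hd2⟩ := hg.exit_iff.mp hd
  by_cases hs : segment ℝ e.1 e.2 = segment ℝ d.1 d.2
  · exact hg.eq_of_segment_eq heE hdE hs
  · have hpt : crossPoint h e = crossPoint h d := by simp [crossPoint, hx]
    have hmem := hg.planar e heE d hdE hs
      ⟨crossPoint_mem_segment he1 (he2 0), hpt ▸ crossPoint_mem_segment hd1 (hd2 0)⟩
    obtain ⟨h1 | h1, h2 | h2⟩ := hmem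
    · exact hg.eq_of_fst_eq heE hdE (h1.symm.trans h2)
    · have := hd2 0
      rw [Function.iterate_zero, id, ← (show _ = d.2 from h2), crossPoint_one] at this
      exact (lt_irrefl _ this).elim
    all_goals
      have := he2 0
      rw [Function.iterate_zero, id, ← (show _ = e.2 from h1), crossPoint_one] at this
      exact (lt_irrefl _ this).elim

end Segments

/-! ### Order of the classes along a level -/

section Interval

/-- The identification of the plane with the complex numbers. -/
noncomputable def toComplex : Plane →ₗ[ℝ] ℂ where
  toFun x := ⟨x 0, x 1⟩
  map_add' x y := by apply Complex.ext <;> simp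
  map_smul' c x := by apply Complex.ext <;> simp

@[simp] lemma toComplex_re (x : Plane) : (toComplex x).re = x 0 := rfl

@[simp] lemma toComplex_im (x : Plane) : (toComplex x).im = x 1 := rfl

lemma toComplex_injective : Function.Injective toComplex := by
  intro x y h
  ext i
  fin_cases i
  · exact congrArg Complex.re h
  · exact congrArg Complex.im h

lemma segment_toComplex (x y : Plane) :
    segment ℝ (toComplex x) (toComplex y) = toComplex '' segment ℝ x y :=
  (image_segment ℝ toComplex.toAffineMap x y).symm

/-- The polygonal path followed from level `h` on by the directed path starting with `e`. -/
noncomputable def pathAbove (g : GeomGraph) (h : ℝ) (e : Arc) : ℕ → Plane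
  | 0 => crossPoint h e
  | n + 1 => (g.succ^[n] e).2

variable {g : GeomGraph} (hg : g.Good) {e d : Arc}

include hg

lemma Good.lt_pathAbove {h : ℝ} (he : g.Exit h e) (n : ℕ) : h < g.pathAbove h e (n + 1) 1 :=
  (hg.exit_iff.mp he).2.2 n

lemma Good.le_pathAbove {h : ℝ} (he : g.Exit h e) (n : ℕ) : h ≤ g.pathAbove h e n 1 := by
  cases n with
  | zero => exact le_rfl
  | succ n => exact (hg.lt_pathAbove he n).le

lemma Good.segment_pathAbove_subset {h : ℝ} (he : g.Exit h e) (n : ℕ) :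
    segment ℝ (g.pathAbove h e n) (g.pathAbove h e (n + 1)) ⊆
      segment ℝ (g.succ^[n] e).1 (g.succ^[n] e).2 := by
  obtain ⟨heE, he1, he2⟩ := hg.exit_iff.mp he
  refine (convex_segment _ _).segment_subset ?_ (right_mem_segment ℝ _ _)
  cases n with
  | zero => exact crossPoint_mem_segment he1 (he2 0)
  | succ n =>
    rw [hg.iterate_succ_fst heE]
    exact left_mem_segment ℝ _ _

/-- The exits at a given level of a given class form an interval. -/
theorem Good.same_of_between {h : ℝ} {e₁ e₂ e₃ : Arc} (h₁ : g.Exit h e₁) (h₂ : g.Exit h e₂)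
    (h₃ : g.Exit h e₃) (h₁₂ : cross h e₁ < cross h e₂) (h₂₃ : cross h e₂ < cross h e₃)
    (hs : g.Same e₁ e₃) : g.Same e₂ e₁ := by
  have E₁ := h₁.1
  have E₂ := h₂.1
  have E₃ := h₃.1
  obtain ⟨m, n, hmn⟩ := (hg.same_iff E₁ E₃).mp hs
  -- The forward path of the middle exit is connected, unbounded and above the level except at its
  -- start, while the outer two paths merge; it must meet one of them.
  set Q : Set ℂ := ⋃ i, segment ℝ (toComplex (g.pathAbove h e₂ i))
    (toComplex (g.pathAbove h e₂ (i + 1))) with hQ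
  -- The indices are shifted by one because `pathAbove` puts the crossing point before the heads of
  -- the successive arcs.
  obtain ⟨q, hq, hor⟩ := exists_mem_segment_of_paths (m := m + 1) (n := n + 1)
    (p := fun i => toComplex (g.pathAbove h e₁ i)) (p' := fun i => toComplex (g.pathAbove h e₃ i))
    (y := toComplex (crossPoint h e₂)) (Q := Q)
    (fun i => hg.le_pathAbove h₁ i) (fun i => hg.le_pathAbove h₃ i)
    (by simp only [pathAbove]; rw [hmn]) rfl rfl h₁₂ h₂₃
    (IsPreconnected.iUnion_of_chain (fun i => (convex_segment _ _).isPreconnected)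
      fun i => ⟨_, right_mem_segment ℝ _ _, left_mem_segment ℝ _ _⟩)
    (Set.mem_iUnion.mpr ⟨0, left_mem_segment ℝ _ _⟩)
    (by
      intro q hq hne
      obtain ⟨i, a, b, ha, hb, hab, rfl⟩ := Set.mem_iUnion.mp hq
      have hi := hg.le_pathAbove h₂ i
      have hi' := hg.lt_pathAbove h₂ i
      have hb0 : b = 0 → i ≠ 0 := by
        rintro rfl rfl
        obtain rfl : a = 1 := by linarith
        exact hne (by simp [pathAbove])
      simp only [toComplex_im, crossPoint_one, Complex.add_im, Complex.real_smul,
        Complex.im_ofReal_mul]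
      cases i with
      | zero =>
        have hb' : 0 < b := lt_of_le_of_ne hb fun h => hb0 h.symm rfl
        have : h = a * h + b * h := by rw [← add_mul, hab, one_mul]
        have h1 := mul_lt_mul_of_pos_left hi' hb'
        have h2 := mul_le_mul_of_nonneg_left hi ha
        linarith
      | succ i =>
        have hi2 := hg.lt_pathAbove h₂ i
        rcases ha.eq_or_lt with rfl | ha
        · obtain rfl : b = 1 := by linarith
          simpa using hi'
        · have : h = a * h + b * h := by rw [← add_mul, hab, one_mul]
          have h1 := mul_le_mul_of_nonneg_left hi'.le hb
          have h2 := mul_lt_mul_of_pos_left hi2 ha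
          linarith)
    (by
      intro hb
      obtain ⟨R, hR⟩ := hb.exists_norm_le
      obtain ⟨n, hn⟩ := ((hg.tendsto_iterate E₂).eventually (eventually_gt_atTop R)).and
        (eventually_ge_atTop 1) |>.exists
      obtain ⟨k, rfl⟩ : ∃ k, n = k + 1 := ⟨n - 1, by omega⟩
      rw [hg.iterate_succ_fst E₂] at hn
      have hle := hR (toComplex (g.pathAbove h e₂ (k + 1)))
        (Set.mem_iUnion.mpr ⟨k, right_mem_segment ℝ _ _⟩)
      have := (Complex.im_le_norm (toComplex (g.pathAbove h e₂ (k + 1)))).trans hle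
      exact absurd hn.1 (not_lt.mpr this))
  obtain ⟨i, hqi⟩ := Set.mem_iUnion.mp hq
  rw [segment_toComplex] at hqi
  obtain ⟨x, hx, rfl⟩ := hqi
  have hx' := hg.segment_pathAbove_subset h₂ i hx
  -- A meeting point lies on an arc of each orbit, so the two orbits merge by
  -- `Good.same_of_mem_segment`.
  have key : ∀ {f : Arc} (hf : g.Exit h f) (j : ℕ), toComplex x ∈
      segment ℝ (toComplex (g.pathAbove h f j)) (toComplex (g.pathAbove h f (j + 1))) →
      g.Same e₂ f := by
    intro f hf j hxj
    rw [segment_toComplex] at hxj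
    obtain ⟨x', hxj, hxx⟩ := hxj
    obtain rfl := toComplex_injective hxx
    have hxj' := hg.segment_pathAbove_subset hf j hxj
    have e1 := hg.iterate_mem E₂ i
    have e2 := hg.iterate_mem hf.1 j
    exact hg.same_trans E₂ e1 hf.1 (hg.same_iterate E₂ i)
      (hg.same_trans e1 e2 hf.1 (hg.same_of_mem_segment e1 e2 hx' hxj')
        (hg.same_iterate hf.1 j).symm)
  rcases hor with ⟨j, hj⟩ | ⟨j, hj⟩
  · exact key h₁ j hj
  · exact hg.same_trans E₂ E₃ E₁ (key h₃ j hj) hs.symm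

end Interval

end GeomGraph

/-! ### Mass transport and other consequences of stationarity -/

namespace GeomGraph

section Counting

/-- The number of arcs satisfying `p`. -/
noncomputable def arcCount (p : Arc → Prop) : ENNReal :=
  ∑' e, open scoped Classical in if p e then 1 else 0

lemma arcCount_eq_tsum (p : Arc → Prop) [DecidablePred p] :
    arcCount p = ∑' e, if p e then 1 else 0 := by
  refine tsum_congr fun e => ?_
  congr

lemma arcCount_eq_encard (p : Arc → Prop) : arcCount p = ({e | p e}.encard : ENNReal) := by
  classical
  rw [← ENNReal.tsum_set_one, tsum_subtype {e | p e} fun _ => (1 : ENNReal)]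
  rfl

lemma arcCount_comp (s : Plane) (p : Arc → Prop) :
    arcCount (fun e => p (shiftArc s e)) = arcCount p := by
  classical
  exact (shiftArc s).tsum_eq fun e => if p e then (1 : ENNReal) else 0

lemma measurable_arcCount {X : Type*} [MeasurableSpace X] {γ : X → GeomGraph} {p : X → Arc → Prop}
    (hγ : Measurable γ) (hp : Measurable (Function.uncurry p)) (hE : ∀ x e, p x e → e ∈ (γ x).E) :
    Measurable fun x => arcCount (p x) := by
  classical
  have hf : Measurable (Function.uncurry fun x e => if p x e then (1 : ENNReal) else 0) :=
    Measurable.ite (measurableSet_setOfPred.mpr hp) measurable_const measurable_const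
  convert measurable_tsum_arcs hγ hf using 2 with x
  refine tsum_congr fun e => ?_
  by_cases h : p x e
  · rw [Set.indicator_of_mem (hE x e h)]
  · simp [h, Set.indicator_apply]

end Counting

section Stationary

variable {Ω : Type*} [MeasurableSpace Ω] {P : Measure Ω} {G : Ω → GeomGraph}
  [AddAction Plane Ω] [MeasurableVAdd₂ Plane Ω] [VAddInvariantMeasure Plane Ω P]

lemma lintegral_vadd (s : Plane) (f : Ω → ENNReal) :
    ∫⁻ ω, f (s +ᵥ ω) ∂P = ∫⁻ ω, f ω ∂P :=
  (measurePreserving_vadd s P).lintegral_comp_emb (measurableEmbedding_const_vadd s) f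

/-- Mass transport principle. Translation by `a - c` turns the mass sent from `c` to `2c - a` into
the mass sent from `a` to `c`, and `a ↦ 2c - a` permutes the group. -/
theorem lintegral_tsum_transport {Γ : Type*} [AddCommGroup Γ] [Countable Γ] (ι : Γ →+ Plane)
    {F : Γ → Γ → Ω → ENNReal} (hF : ∀ a b, Measurable (F a b))
    (hinv : ∀ γ a b ω, F (a + γ) (b + γ) (ι γ +ᵥ ω) = F a b ω) (c : Γ) :
    ∫⁻ ω, ∑' b, F c b ω ∂P = ∫⁻ ω, ∑' a, F a c ω ∂P := by
  rw [lintegral_tsum fun b => (hF c b).aemeasurable, lintegral_tsum fun a => (hF a c).aemeasurable,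
    ← (Equiv.subLeft (c + c)).tsum_eq]
  refine tsum_congr fun a => ?_
  rw [← lintegral_vadd (ι (a - c)) (F a c)]
  refine lintegral_congr fun ω => ?_
  have := hinv (a - c) c (c + c - a) ω
  rw [show c + (a - c) = a by abel, show c + c - a + (a - c) = c by abel] at this
  rw [Equiv.subLeft_apply, this]

/-- A property of arcs, depending on the graph, which implies membership in the graph, and which is
jointly measurable and invariant under the translations by the vectors `ι γ`. -/
structure IsArcFactor {Γ : Type*} [AddCommGroup Γ] (ι : Γ →+ Plane)
    (S : GeomGraph → Arc → Prop) : Prop where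
  mem_E : ∀ g e, S g e → e ∈ g.E
  measurable : Measurable (Function.uncurry S)
  translate : ∀ γ g e, S (g.translate (ι γ)) (shiftArc (ι γ) e) ↔ S g e

/-- An equivariant measurable labelling of arcs. -/
structure IsArcLabel {Γ : Type*} [AddCommGroup Γ] (ι : Γ →+ Plane) (pos : Arc → Γ) : Prop where
  measurable : ∀ c, Measurable fun e => pos e = c
  shift : ∀ γ e, pos (shiftArc (ι γ) e) = pos e + γ

variable {Γ : Type*} [AddCommGroup Γ] [Countable Γ] {ι : Γ →+ Plane}

omit [Countable Γ] in
lemma measurable_factor {X : Type*} [MeasurableSpace X] {S : GeomGraph → Arc → Prop}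
    (hS : IsArcFactor ι S) {γ : X → GeomGraph} {a : X → Arc} (hγ : Measurable γ)
    (ha : Measurable a) : Measurable fun x => S (γ x) (a x) :=
  hS.measurable.comp (hγ.prodMk ha)

/-- If every arc of `S'` is the image of some arc of `S`, every arc of `S` has at most one image,
and `S` is at most as dense as `S'`, then the correspondence is bijective. -/
theorem ae_bijective_of_transport {S S' : GeomGraph → Arc → Prop}
    {R : GeomGraph → Arc → Arc → Prop} {pos pos' : Arc → Γ}
    (hG : Measurable G) (hT : ∀ (s : Plane) (ω : Ω), G (s +ᵥ ω) = (G ω).translate s)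
    (hS : IsArcFactor ι S) (hS' : IsArcFactor ι S')
    (hRm : Measurable fun x : GeomGraph × Arc × Arc => R x.1 x.2.1 x.2.2)
    (hRt : ∀ γ g e d, R (g.translate (ι γ)) (shiftArc (ι γ) e) (shiftArc (ι γ) d) ↔ R g e d)
    (hpos : IsArcLabel ι pos) (hpos' : IsArcLabel ι pos')
    (hin : ∀ᵐ ω ∂P, ∀ d, S' (G ω) d → ∃ e, S (G ω) e ∧ R (G ω) e d)
    (hout : ∀ᵐ ω ∂P, ∀ e d d', S (G ω) e → S' (G ω) d → S' (G ω) d' → R (G ω) e d →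
      R (G ω) e d' → d = d')
    (hle : ∀ c, ∫⁻ ω, arcCount (fun e => S (G ω) e ∧ pos e = c) ∂P ≤
      ∫⁻ ω, arcCount (fun e => S' (G ω) e ∧ pos' e = c) ∂P)
    (hfin : ∀ c, ∫⁻ ω, arcCount (fun e => S' (G ω) e ∧ pos' e = c) ∂P < ⊤) :
    ∀ᵐ ω ∂P, (∀ e, S (G ω) e → ∃ d, S' (G ω) d ∧ R (G ω) e d) ∧
      ∀ d e e', S' (G ω) d → S (G ω) e → S (G ω) e' → R (G ω) e d → R (G ω) e' d → e = e' := by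
  classical
  have hAm : ∀ c, Measurable fun ω => arcCount (fun e => S (G ω) e ∧ pos e = c) := fun c =>
    measurable_arcCount hG
      ((measurable_factor hS (hG.comp measurable_fst) measurable_snd).and
        ((hpos.measurable c).comp measurable_snd)) fun ω e h => hS.mem_E _ _ h.1
  have hBm : ∀ c, Measurable fun ω => arcCount (fun e => S' (G ω) e ∧ pos' e = c) := fun c =>
    measurable_arcCount hG
      ((measurable_factor hS' (hG.comp measurable_fst) measurable_snd).and
        ((hpos'.measurable c).comp measurable_snd)) fun ω e h => hS'.mem_E _ _ h.1
  set q : Γ → Γ → Ω → Arc → Arc → Prop := fun a b ω e d =>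
    (S (G ω) e ∧ pos e = a) ∧ (S' (G ω) d ∧ R (G ω) e d) ∧ pos' d = b with hq
  -- The mass sent from cell `a` to cell `b` is the number of related pairs located there. The mass
  -- out of a cell is at most the number of its `S`-arcs, the mass into it at least the number of
  -- its `S'`-arcs.
  set F : Γ → Γ → Ω → ENNReal := fun a b ω => ∑' e, arcCount (q a b ω e) with hFdef
  have hRm' : Measurable fun x : (Ω × Arc) × Arc => R (G x.1.1) x.1.2 x.2 :=
    hRm.comp ((hG.comp measurable_fst.fst).prodMk
      (measurable_fst.snd.prodMk measurable_snd))
  have hF : ∀ a b, Measurable (F a b) := by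
    intro a b
    have h1 : Measurable (Function.uncurry fun ω e => arcCount (q a b ω e)) := by
      refine measurable_arcCount (X := Ω × Arc) (γ := fun x => G x.1)
        (p := fun x d => q a b x.1 x.2 d) (hG.comp measurable_fst) ?_
        fun x d h => hS'.mem_E _ _ h.2.1.1
      refine Measurable.and (Measurable.and ?_ ?_) (Measurable.and (Measurable.and ?_ hRm') ?_)
      · exact measurable_factor hS (hG.comp measurable_fst.fst) measurable_fst.snd
      · exact (hpos.measurable a).comp measurable_fst.snd
      · exact measurable_factor hS' (hG.comp measurable_fst.fst) measurable_snd
      · exact (hpos'.measurable b).comp measurable_snd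
    convert measurable_tsum_arcs hG h1 using 2 with ω
    refine tsum_congr fun e => ?_
    by_cases h : e ∈ (G ω).E
    · rw [Set.indicator_of_mem h]
    · rw [Set.indicator_of_notMem h]
      have : ∀ d, ¬ q a b ω e d := fun d hd => h (hS.mem_E _ _ hd.1.1)
      simp [arcCount, this]
  have hinv : ∀ γ a b ω, F (a + γ) (b + γ) (ι γ +ᵥ ω) = F a b ω := by
    intro γ a b ω
    simp only [hFdef]
    rw [← (shiftArc (ι γ)).tsum_eq]
    refine tsum_congr fun e => ?_
    rw [← arcCount_comp (ι γ)]
    simp only [hq, hT, hS.translate, hS'.translate, hRt, hpos.shift, hpos'.shift, add_left_inj]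
  have hL : ∀ c ω, ∑' b, F c b ω =
      ∑' e, if S (G ω) e ∧ pos e = c then arcCount (fun d => S' (G ω) d ∧ R (G ω) e d) else 0 := by
    intro c ω
    rw [ENNReal.tsum_comm]
    refine tsum_congr fun e => ?_
    split_ifs with h
    · simp only [arcCount]
      rw [ENNReal.tsum_comm]
      refine tsum_congr fun d => ?_
      rw [tsum_eq_single (pos' d)]
      · simp only [hq, h]; simp
      · intro b hb
        exact if_neg fun hh => hb hh.2.2.symm
    · simp [arcCount, hq, h]
  have hR : ∀ c ω, ∑' a, F a c ω =
      ∑' d, if S' (G ω) d ∧ pos' d = c then arcCount (fun e => S (G ω) e ∧ R (G ω) e d) else 0 := by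
    intro c ω
    have h1 : ∀ a, F a c ω = ∑' d, ∑' e, if q a c ω e d then (1 : ENNReal) else 0 := fun a => by
      simp only [hFdef, arcCount_eq_tsum]
      exact ENNReal.tsum_comm
    simp only [h1]
    rw [ENNReal.tsum_comm]
    refine tsum_congr fun d => ?_
    split_ifs with h
    · simp only [arcCount]
      rw [ENNReal.tsum_comm]
      refine tsum_congr fun e => ?_
      rw [tsum_eq_single (pos e)]
      · congr 1
        simp only [hq, h.1, h.2, and_true, true_and]
      · intro b hb
        exact if_neg fun hh => hb hh.1.2.symm
    · rw [ENNReal.tsum_eq_zero]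
      intro a
      rw [ENNReal.tsum_eq_zero]
      intro e
      exact if_neg fun hh => h ⟨hh.2.1.1, hh.2.2⟩
  have hone : ∀ p : Arc → Prop, (∀ d d', p d → p d' → d = d') → arcCount p ≤ 1 := by
    intro p hp
    rw [arcCount_eq_encard]
    have : {e | p e}.encard ≤ 1 := Set.encard_le_one_iff.mpr fun a b ha hb => hp a b ha hb
    exact_mod_cast this
  have hone' : ∀ p : Arc → Prop, ∀ d, p d → 1 ≤ arcCount p := by
    intro p d hd
    rw [arcCount_eq_encard]
    have : 1 ≤ {e | p e}.encard := Set.one_le_encard_iff_nonempty.mpr ⟨d, hd⟩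
    exact_mod_cast this
  have main : ∀ c, ∀ᵐ ω ∂P, (∀ e, S (G ω) e → pos e = c → ∃ d, S' (G ω) d ∧ R (G ω) e d) ∧
      ∀ d e e', S' (G ω) d → pos' d = c → S (G ω) e → S (G ω) e' → R (G ω) e d →
        R (G ω) e' d → e = e' := by
    intro c
    have hLA : ∀ᵐ ω ∂P, ∀ e, (if S (G ω) e ∧ pos e = c then
        arcCount (fun d => S' (G ω) d ∧ R (G ω) e d) else 0) ≤
        if S (G ω) e ∧ pos e = c then (1 : ENNReal) else 0 := by
      filter_upwards [hout] with ω hω e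
      split_ifs with h
      · exact hone _ fun d d' hd hd' => hω e d d' h.1 hd.1 hd'.1 hd.2 hd'.2
      · exact le_rfl
    have hBR : ∀ᵐ ω ∂P, ∀ d, (if S' (G ω) d ∧ pos' d = c then (1 : ENNReal) else 0) ≤
        if S' (G ω) d ∧ pos' d = c then arcCount (fun e => S (G ω) e ∧ R (G ω) e d) else 0 := by
      filter_upwards [hin] with ω hω d
      split_ifs with h
      · obtain ⟨e, he⟩ := hω d h.1
        exact hone' _ e he
      · exact le_rfl
    have i1 : ∫⁻ ω, ∑' b, F c b ω ∂P ≤ ∫⁻ ω, arcCount (fun e => S (G ω) e ∧ pos e = c) ∂P := by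
      refine lintegral_mono_ae ?_
      filter_upwards [hLA] with ω hω
      rw [hL]
      exact (ENNReal.tsum_le_tsum hω).trans (@arcCount_eq_tsum _ _).ge
    have i2 : ∫⁻ ω, arcCount (fun e => S' (G ω) e ∧ pos' e = c) ∂P ≤ ∫⁻ ω, ∑' a, F a c ω ∂P := by
      refine lintegral_mono_ae ?_
      filter_upwards [hBR] with ω hω
      rw [hR]
      exact (@arcCount_eq_tsum _ _).le.trans (ENNReal.tsum_le_tsum hω)
    have i3 := lintegral_tsum_transport (P := P) ι hF hinv c
    -- Transport and `hle` close the chain of inequalities between finite expectations, so both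
    -- pointwise bounds are equalities almost everywhere.
    have j1 : (fun ω => ∑' b, F c b ω) =ᵐ[P] fun ω => arcCount (fun e => S (G ω) e ∧ pos e = c) := by
      refine ae_eq_of_ae_le_of_lintegral_le ?_ (i1.trans_lt ((hle c).trans_lt (hfin c))).ne
        (hAm c).aemeasurable (((hle c).trans i2).trans i3.ge)
      filter_upwards [hLA] with ω hω
      rw [hL]
      exact (ENNReal.tsum_le_tsum hω).trans (@arcCount_eq_tsum _ _).ge
    have j2 : (fun ω => arcCount (fun e => S' (G ω) e ∧ pos' e = c)) =ᵐ[P]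
        fun ω => ∑' a, F a c ω := by
      refine ae_eq_of_ae_le_of_lintegral_le ?_ (hfin c).ne
        (Measurable.tsum fun a => hF a c).aemeasurable
        ((i3.ge.trans i1).trans (hle c))
      filter_upwards [hBR] with ω hω
      rw [hR]
      exact (@arcCount_eq_tsum _ _).le.trans (ENNReal.tsum_le_tsum hω)
    have f1 := ae_lt_top (hAm c) ((hle c).trans_lt (hfin c)).ne
    have f2 := ae_lt_top (hBm c) (hfin c).ne
    filter_upwards [hLA, hBR, j1, j2, f1, f2] with ω h1 h2 h3 h4 h5 h6
    rw [hL] at h3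
    rw [hR] at h4
    constructor
    · intro e he hec
      by_contra! hno
      -- A single arc without image would make the termwise bound strict in a finite sum; the same
      -- argument below excludes an arc with two preimages.
      refine (ENNReal.tsum_lt_tsum (i := e) (by rw [h3]; exact h5.ne) h1 ?_).ne
        (h3.trans (@arcCount_eq_tsum _ _))
      rw [if_pos ⟨he, hec⟩, if_pos ⟨he, hec⟩]
      have : ∀ d, ¬ (S' (G ω) d ∧ R (G ω) e d) := fun d hd => hno d hd.1 hd.2
      simp [arcCount, this]
    · intro d e e' hd hdc he he' hr hr'
      by_contra hne
      refine (ENNReal.tsum_lt_tsum (i := d) ((@arcCount_eq_tsum _ _).symm.trans_lt h6).ne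
        h2 ?_).ne ((@arcCount_eq_tsum _ _).symm.trans h4)
      rw [if_pos ⟨hd, hdc⟩, if_pos ⟨hd, hdc⟩, arcCount_eq_encard]
      have : 1 < {e | S (G ω) e ∧ R (G ω) e d}.encard :=
        Set.one_lt_encard_iff.mpr ⟨e, e', ⟨he, hr⟩, ⟨he', hr'⟩, hne⟩
      exact_mod_cast this
  filter_upwards [ae_all_iff.mpr main] with ω hω
  exact ⟨fun e he => (hω (pos e)).1 e he rfl, fun d e e' hd => (hω (pos' d)).2 d e e' hd rfl⟩

omit [MeasurableVAdd₂ Plane Ω] in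
-- The events that the least occupied label is `m`, for `m` in `ℤ`, are disjoint and equally likely,
-- hence null under a finite measure.
theorem ae_exists_lt [IsFiniteMeasure P] {S : GeomGraph → Arc → Prop} {ι : ℤ →+ Plane}
    {pos : Arc → ℤ} (hG : Measurable G) (hT : ∀ (s : Plane) (ω : Ω), G (s +ᵥ ω) = (G ω).translate s)
    (hS : IsArcFactor ι S) (hpos : IsArcLabel ι pos) :
    ∀ᵐ ω ∂P, (∃ e, S (G ω) e) → ∀ m, ∃ e, S (G ω) e ∧ pos e < m := by
  set B : ℤ → Set Ω := fun m => {ω | (∃ e ∈ (G ω).E, S (G ω) e ∧ pos e = m) ∧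
    ∀ e ∈ (G ω).E, S (G ω) e → ¬ pos e < m} with hB
  have hlt : ∀ m, Measurable fun e => pos e < m := by
    intro m
    have : (fun e => pos e < m) = fun e => ∃ k : ℤ, k < m ∧ pos e = k := by
      funext e
      simp
    rw [this]
    exact Measurable.exists fun k => measurable_const.and (hpos.measurable k)
  have hBm : ∀ m, MeasurableSet (B m) := by
    intro m
    refine measurableSet_setOfPred.mpr (Measurable.and ?_ ?_)
    · exact measurable_exists_arc hG
        ((measurable_factor hS (hG.comp measurable_fst) measurable_snd).and
          ((hpos.measurable m).comp measurable_snd))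
    · exact measurable_forall_arc hG
        ((measurable_factor hS (hG.comp measurable_fst) measurable_snd).imp
          ((hlt m).comp measurable_snd).not)
  have hBinv : ∀ m, P (B m) = P (B 0) := by
    intro m
    have : (fun ω => ι m +ᵥ ω) ⁻¹' B m = B 0 := by
      ext ω
      simp only [hB, Set.mem_preimage, Set.mem_ofPred_eq, hT, exists_mem_translate,
        forall_mem_translate, hS.translate, hpos.shift]
      simp
    rw [← this, measure_preimage_vadd]
  have hdis : Pairwise (Function.onFun Disjoint B) := by
    have key : ∀ m n : ℤ, m < n → ∀ ω, ω ∈ B m → ω ∈ B n → False := by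
      rintro m n hmn ω ⟨⟨e, heE, he, hem⟩, -⟩ ⟨-, h2⟩
      exact h2 e heE he (by omega)
    intro m n hmn
    refine Set.disjoint_left.mpr fun ω h1 h2 => ?_
    rcases lt_or_gt_of_ne hmn with h | h
    · exact key m n h ω h1 h2
    · exact key n m h ω h2 h1
  have hzero : P (B 0) = 0 := by
    by_contra hne
    have h1 : ∑' m : ℤ, P (B m) = P (⋃ m, B m) := (measure_iUnion hdis hBm).symm
    simp only [hBinv] at h1
    rw [ENNReal.tsum_const_eq_top_of_ne_zero hne] at h1
    exact measure_ne_top _ _ h1.symm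
  have hae : ∀ᵐ ω ∂P, ∀ m, ω ∉ B m :=
    ae_all_iff.mpr fun m => measure_eq_zero_iff_ae_notMem.mp ((hBinv m).trans hzero)
  filter_upwards [hae] with ω hω
  rintro ⟨e, he⟩ m
  by_contra! hno
  obtain ⟨k, ⟨e', he', hk⟩, hmin⟩ := Int.exists_least_of_bdd
    (P := fun k => ∃ e, S (G ω) e ∧ pos e = k) ⟨m, by rintro _ ⟨e, he, rfl⟩; exact hno e he⟩
    ⟨_, e, he, rfl⟩
  refine hω k ⟨⟨e', hS.mem_E _ _ he', he', hk⟩, fun d _ hd hlt => ?_⟩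
  exact absurd (hmin _ ⟨d, hd, rfl⟩) (not_le.mpr hlt)

omit [MeasurableVAdd₂ Plane Ω] in
theorem ae_exists_gt [IsFiniteMeasure P] {S : GeomGraph → Arc → Prop} {ι : ℤ →+ Plane}
    {pos : Arc → ℤ} (hG : Measurable G) (hT : ∀ (s : Plane) (ω : Ω), G (s +ᵥ ω) = (G ω).translate s)
    (hS : IsArcFactor ι S) (hpos : IsArcLabel ι pos) :
    ∀ᵐ ω ∂P, (∃ e, S (G ω) e) → ∀ m, ∃ e, S (G ω) e ∧ m < pos e := by
  have h := ae_exists_lt (P := P) (S := S) (ι := -ι) (pos := fun e => -pos e) hG hT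
    ⟨hS.mem_E, hS.measurable, fun γ g e => by simpa using hS.translate (-γ) g e⟩
    ⟨fun c => by simpa [neg_eq_iff_eq_neg] using hpos.measurable (-c), fun γ e => by
      have := hpos.shift (-γ) e
      simp only [map_neg] at this
      simp only [AddMonoidHom.neg_apply, this]
      ring⟩
  filter_upwards [h] with ω hω hne m
  obtain ⟨e, he, hlt⟩ := hω hne (-m)
  exact ⟨e, he, by omega⟩

/-- After translation by `s`, every arc counted meets the unit square, and stationarity leaves the
expectation unchanged. -/
lemma lintegral_arcCount_lt_top (hT : ∀ (s : Plane) (ω : Ω), G (s +ᵥ ω) = (G ω).translate s)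
    (hfin : ∫⁻ ω, ((G ω).unitSquareEdgeCount : ENNReal) ∂P < ⊤) (s : Plane)
    {q : Ω → Arc → Prop} (hq : ∀ ω e, q ω e → e ∈ (G ω).E)
    (hs : ∀ ω e, q ω e → ∃ x ∈ segment ℝ e.1 e.2, x + s ∈ unitSquare) :
    ∫⁻ ω, arcCount (q ω) ∂P < ⊤ := by
  rw [← lintegral_vadd s] at hfin
  refine (lintegral_mono fun ω => ?_).trans_lt hfin
  rw [arcCount_eq_encard]
  refine ENat.toENNReal_le.mpr (Set.encard_le_encard_of_injOn (f := shiftArc s) ?_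
    (shiftArc s).injective.injOn)
  intro e he
  rw [hT]
  refine ⟨(shiftArc_mem_translate _ _).mpr (hq ω e he), ?_⟩
  obtain ⟨x, hx, hxs⟩ := hs ω e he
  refine ⟨x + s, ?_, hxs⟩
  obtain ⟨a, b, ha, hb, hab, rfl⟩ := hx
  refine ⟨a, b, ha, hb, hab, ?_⟩
  have : s = (a + b) • s := by rw [hab, one_smul]
  simp only [shiftArc_fst, shiftArc_snd, smul_add]
  conv_rhs => rw [this, add_smul]
  abel

end Stationary

end GeomGraph

/-! ### Almost sure structure of the exits and bi-infinite paths -/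

namespace GeomGraph

section Lattice

/-- The integer points of the plane. -/
noncomputable def latticePoint : ℤ × ℤ →+ Plane where
  toFun p := !₂[(p.1 : ℝ), (p.2 : ℝ)]
  map_zero' := by ext i; fin_cases i <;> simp
  map_add' p q := by ext i; fin_cases i <;> simp

@[simp] lemma latticePoint_zero (p : ℤ × ℤ) : latticePoint p 0 = p.1 := rfl

@[simp] lemma latticePoint_one (p : ℤ × ℤ) : latticePoint p 1 = p.2 := rfl

/-- The horizontal integer translations. -/
noncomputable def horizontal : ℤ →+ Plane := latticePoint.comp (AddMonoidHom.inl ℤ ℤ)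

@[simp] lemma horizontal_zero (k : ℤ) : horizontal k 0 = k := rfl

@[simp] lemma horizontal_one (k : ℤ) : horizontal k 1 = 0 := by
  simp [horizontal]

/-- The integer cell containing the tail of an arc. -/
noncomputable def tailCell (e : Arc) : ℤ × ℤ := (⌊e.1 0⌋, ⌊e.1 1⌋)

lemma isArcLabel_tailCell : IsArcLabel latticePoint tailCell where
  measurable c := by
    have h : ∀ i, Measurable fun e : Arc => ⌊e.1 i⌋ := fun i =>
      Int.measurable_floor.comp ((measurable_coord i).comp measurable_fst)
    exact measurableSet_setOfPred.mp (measurableSet_eq_fun ((h 0).prodMk (h 1)) measurable_const)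
  shift γ e := by ext <;> simp [tailCell]

/-- The integer interval containing the crossing point of an arc with the level `h`. -/
noncomputable def crossCell (h : ℝ) (e : Arc) : ℤ := ⌊cross h e⌋

lemma cross_horizontal (h : ℝ) (k : ℤ) (e : Arc) :
    cross h (shiftArc (horizontal k) e) = cross h e + k := by
  have := cross_shiftArc (horizontal k) h e
  rwa [horizontal_one, add_zero, horizontal_zero] at this

lemma isArcLabel_crossCell (h : ℝ) : IsArcLabel horizontal (crossCell h) where
  measurable c := measurableSet_setOfPred.mp
    (measurableSet_eq_fun (Int.measurable_floor.comp (measurable_cross h)) measurable_const)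
  shift γ e := by simp [crossCell, cross_horizontal]

lemma exit_horizontal (g : GeomGraph) (h : ℝ) (k : ℤ) (e : Arc) :
    (g.translate (horizontal k)).Exit h (shiftArc (horizontal k) e) ↔ g.Exit h e := by
  have := exit_translate g (horizontal k) (h := h) (e := e)
  rwa [horizontal_one, add_zero] at this

/-- Only horizontal translations preserve a level, hence the group `ℤ` here, whereas `Bi` refers to
no level and admits all lattice translations. -/
lemma isArcFactor_exit (h : ℝ) : IsArcFactor horizontal fun g => g.Exit h where
  mem_E _ _ he := he.1
  measurable := measurable_exit h measurable_fst measurable_snd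
  translate k g e := exit_horizontal g h k e

lemma isArcFactor_bi {Γ : Type*} [AddCommGroup Γ] (ι : Γ →+ Plane) : IsArcFactor ι Bi where
  mem_E _ _ he := he.1
  measurable := measurable_bi measurable_fst measurable_snd
  translate _ g _ := bi_translate g _

lemma isArcFactor_rightmost (h : ℝ) : IsArcFactor horizontal fun g => g.Rightmost h where
  mem_E _ _ he := he.1.1
  measurable := measurable_rightmost h measurable_fst measurable_snd
  translate k g e := by
    have := rightmost_translate g (horizontal k) (h := h) (e := e)
    rwa [horizontal_one, add_zero] at this

/-- For `σ = 1` (resp. `σ = -1`): all exits to the right (resp. left) of `e` are in the class of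
`e`, but not all exits are. -/
def Terminal (g : GeomGraph) (σ h : ℝ) (e : Arc) : Prop :=
  g.Exit h e ∧ (∀ d ∈ g.E, g.Exit h d → σ * cross h e ≤ σ * cross h d → g.Same e d) ∧
    ∃ d ∈ g.E, g.Exit h d ∧ ¬ g.Same e d

lemma isArcFactor_terminal (σ h : ℝ) : IsArcFactor horizontal fun g => g.Terminal σ h where
  mem_E _ _ he := he.1.1
  measurable := by
    have hγ : Measurable fun x : (GeomGraph × Arc) × Arc => x.1.1 := measurable_fst.fst
    refine (measurable_exit h measurable_fst measurable_snd).and (Measurable.and ?_ ?_)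
    · refine measurable_forall_arc measurable_fst (Measurable.imp ?_ (Measurable.imp ?_ ?_))
      · exact measurable_exit h hγ measurable_snd
      · exact measurableSet_setOfPred.mp (measurableSet_le
          (((measurable_cross h).comp measurable_fst.snd).const_mul σ)
          (((measurable_cross h).comp measurable_snd).const_mul σ))
      · exact measurable_same hγ measurable_fst.snd measurable_snd
    · refine measurable_exists_arc measurable_fst (Measurable.and ?_ ?_)
      · exact measurable_exit h hγ measurable_snd
      · exact (measurable_same hγ measurable_fst.snd measurable_snd).not
  translate k g e := by
    simp only [Terminal, exists_mem_translate, forall_mem_translate, exit_horizontal,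
      same_translate, cross_horizontal, mul_add, add_le_add_iff_right]

end Lattice

namespace Good

variable {g : GeomGraph} (hg : g.Good) {e d : Arc}

include hg

lemma iter_succ' {n : ℕ} (he : e ∈ g.E) (h : g.Iter (n + 1) e d) :
    ∃ c ∈ g.E, g.Iter n e c ∧ c.2 = d.1 := by
  rw [hg.iter_iff he] at h
  refine ⟨g.succ^[n] e, hg.iterate_mem he n, (hg.iter_iff he).mpr rfl, ?_⟩
  rw [← h, hg.iterate_succ_fst he]

/-- König's argument: the finitely many predecessors share the ancestors of all generations, so one
of them serves infinitely many generations. -/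
lemma exists_bi_pred (hd : g.Bi d) : ∃ e, g.Bi e ∧ e.2 = d.1 := by
  have h1 : ∀ n, ∃ c ∈ {c ∈ g.E | c.2 = d.1}, ∃ a ∈ g.E, g.Iter n a c := by
    intro n
    obtain ⟨a, ha, hn⟩ := hd.2 (n + 1)
    obtain ⟨c, hc, hac, hcd⟩ := hg.iter_succ' ha hn
    exact ⟨c, ⟨hc, hcd⟩, a, ha, hac⟩
  choose c hc hcn using h1
  obtain ⟨e, he⟩ : ∃ e ∈ {c ∈ g.E | c.2 = d.1}, ∃ᶠ n in atTop, c n = e := by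
    have hfin := hg.finite_pred d.1
    by_contra! hno
    have hev : ∀ᶠ n in atTop, ∀ e ∈ {c ∈ g.E | c.2 = d.1}, c n ≠ e :=
      (eventually_all_finite hfin).mpr fun e he => by simpa using hno e he
    obtain ⟨n, hn⟩ := hev.exists
    exact hn _ (hc n) rfl
  obtain ⟨⟨heE, hed⟩, hfreq⟩ := he
  refine ⟨e, ⟨heE, fun n => ?_⟩, hed⟩
  obtain ⟨N, hN, rfl⟩ := (frequently_atTop.mp hfreq) n
  obtain ⟨a, ha, haN⟩ := hcn N
  rw [hg.iter_iff ha] at haN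
  -- An ancestor of generation `N ≥ n`, advanced by `N - n` steps, is one of generation exactly `n`.
  refine ⟨g.succ^[N - n] a, hg.iterate_mem ha _, (hg.iter_iff (hg.iterate_mem ha _)).mpr ?_⟩
  rw [← Function.iterate_add_apply, ← haN]
  congr 1
  omega

/-- A class of exits is finite unless it contains all exits. -/
lemma finite_class {h : ℤ} (hR : ∀ e, ¬ g.Terminal 1 h e) (hL : ∀ e, ¬ g.Terminal (-1) h e)
    (he : g.Exit h e) (hd : g.Exit h d) (hed : ¬ g.Same e d) :
    {c | g.Exit h c ∧ g.Same e c}.Finite := by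
  -- As `e` is not terminal on either side, exits outside its class occur on both sides, and the
  -- interval property confines the class between them.
  have h1 : ∃ r, g.Exit h r ∧ cross h e ≤ cross h r ∧ ¬ g.Same e r := by
    by_contra! hno
    exact hR e ⟨he, fun r _ hr hle => hno r hr (by simpa using hle), d, hd.1, hd, hed⟩
  have h2 : ∃ l, g.Exit h l ∧ cross h l ≤ cross h e ∧ ¬ g.Same e l := by
    by_contra! hno
    exact hL e ⟨he, fun r _ hr hle => hno r hr (by linarith), d, hd.1, hd, hed⟩
  obtain ⟨r, hr, hr1, hr2⟩ := h1
  obtain ⟨l, hl, hl1, hl2⟩ := h2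
  have hr3 : cross h e < cross h r := lt_of_le_of_ne hr1 fun heq => hr2 (by
    rw [← hg.eq_of_cross_eq he hr heq]; exact hg.same_refl he.1)
  have hl3 : cross h l < cross h e := lt_of_le_of_ne hl1 fun heq => hl2 (by
    rw [hg.eq_of_cross_eq hl he heq]; exact hg.same_refl he.1)
  refine (Set.Finite.biUnion (Set.finite_Icc (crossCell h l) (crossCell h r))
    fun k _ => hg.finite_cross h k).subset ?_
  rintro c ⟨hc, hec⟩
  have hcr : cross h c ≤ cross h r := by
    by_contra! hlt
    exact hr2 (hg.same_of_between he hr hc hr3 hlt hec).symm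
  have hlc : cross h l ≤ cross h c := by
    by_contra! hlt
    exact hl2 (hg.same_trans he.1 hc.1 hl.1 hec
      (hg.same_of_between hc hl he hlt hl3 hec.symm).symm)
  exact Set.mem_biUnion (x := crossCell h c) ⟨Int.floor_mono hlc, Int.floor_mono hcr⟩
    ⟨hc.1, hc.2.1, (hg.exit_iff.mp hc).2.2 0, rfl⟩

lemma exists_rightmost {h : ℤ} (hR : ∀ e, ¬ g.Terminal 1 h e) (hL : ∀ e, ¬ g.Terminal (-1) h e)
    (he : g.Exit h e) (hd : g.Exit h d) (hed : ¬ g.Same e d) :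
    ∃ c, g.Rightmost h c ∧ g.Same e c := by
  obtain ⟨c, ⟨hc, hec⟩, hmax⟩ := Set.exists_max_image _ (cross h)
    (hg.finite_class hR hL he hd hed) ⟨e, he, hg.same_refl he.1⟩
  exact ⟨c, ⟨hc, fun b hb hbx hcb => hmax b ⟨hbx, hg.same_trans he.1 hc.1 hb hec hcb⟩⟩, hec⟩

lemma rightmost_unique {h : ℝ} (he : g.Rightmost h e) (hd : g.Rightmost h d) (hs : g.Same e d) :
    e = d :=
  hg.eq_of_cross_eq he.1 hd.1
    (le_antisymm (hd.2 e he.1.1 he.1 hs.symm) (he.2 d hd.1.1 hd.1 hs))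

end Good

/-- The almost sure consequences of stationarity. -/
structure Generic (g : GeomGraph) : Prop extends g.Good where
  exists_exit_lt : ∀ h : ℤ, (∃ e, g.Exit h e) → ∀ m : ℤ, ∃ e, g.Exit h e ∧ crossCell h e < m
  not_terminal : ∀ (h : ℤ) e, ¬ g.Terminal 1 h e
  not_terminal_neg : ∀ (h : ℤ) e, ¬ g.Terminal (-1) h e
  bi_unique : ∀ d e e', g.Bi d → g.Bi e → g.Bi e' → e.2 = d.1 → e'.2 = d.1 → e = e'
  exists_bi_lt : ∀ h : ℤ, (∃ e, g.Exit h e ∧ g.Bi e) →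
    ∀ m : ℤ, ∃ e, (g.Exit h e ∧ g.Bi e) ∧ crossCell h e < m
  exists_rightmost_below : ∀ (h : ℤ) e, g.Rightmost (h + 1 : ℤ) e → ∃ d, g.Rightmost h d ∧ g.Same e d

section Stationary

variable {Ω : Type*} [MeasurableSpace Ω] {P : Measure Ω} [IsFiniteMeasure P] {G : Ω → GeomGraph}
  [AddAction Plane Ω] [MeasurableVAdd₂ Plane Ω] [VAddInvariantMeasure Plane Ω P]

omit [IsFiniteMeasure P] in
lemma lintegral_cross_lt_top (hT : ∀ (s : Plane) (ω : Ω), G (s +ᵥ ω) = (G ω).translate s)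
    (hfin : ∫⁻ ω, ((G ω).unitSquareEdgeCount : ENNReal) ∂P < ⊤) (h k : ℤ) :
    ∫⁻ ω, arcCount (fun e => e ∈ (G ω).E ∧ e.1 1 ≤ h ∧ (h : ℝ) < e.2 1 ∧ crossCell h e = k) ∂P
      < ⊤ := by
  refine lintegral_arcCount_lt_top hT hfin (latticePoint (-k, -h)) (fun ω e he => he.1) ?_
  rintro ω e ⟨-, h1, h2, rfl⟩
  refine ⟨crossPoint h e, crossPoint_mem_segment h1 h2, fun i => ?_⟩
  fin_cases i
  · have h3 := Int.floor_le (cross h e)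
    have h4 := Int.lt_floor_add_one (cross h e)
    simp [crossCell]
    constructor <;> linarith
  · simp

omit [IsFiniteMeasure P] in
lemma ae_finite_cross (hG : Measurable G)
    (hT : ∀ (s : Plane) (ω : Ω), G (s +ᵥ ω) = (G ω).translate s)
    (hfin : ∫⁻ ω, ((G ω).unitSquareEdgeCount : ENNReal) ∂P < ⊤) :
    ∀ᵐ ω ∂P, ∀ h k : ℤ,
      {e ∈ (G ω).E | e.1 1 ≤ h ∧ (h : ℝ) < e.2 1 ∧ ⌊cross h e⌋ = k}.Finite := by
  rw [ae_all_iff]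
  intro h
  rw [ae_all_iff]
  intro k
  have hm : Measurable fun ω => arcCount
      (fun e => e ∈ (G ω).E ∧ e.1 1 ≤ h ∧ (h : ℝ) < e.2 1 ∧ crossCell h e = k) := by
    refine measurable_arcCount hG ?_ fun ω e he => he.1
    refine (measurable_mem_E (hG.comp measurable_fst) measurable_snd).and
      (Measurable.and ?_ (Measurable.and ?_ ?_))
    · exact measurableSet_setOfPred.mp
        (measurableSet_le ((measurable_coord 1).comp measurable_snd.fst) measurable_const)
    · exact measurableSet_setOfPred.mp
        (measurableSet_lt measurable_const ((measurable_coord 1).comp measurable_snd.snd))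
    · exact ((isArcLabel_crossCell h).measurable k).comp measurable_snd
  filter_upwards [ae_lt_top hm (lintegral_cross_lt_top hT hfin h k).ne] with ω hω
  rw [arcCount_eq_encard] at hω
  refine Set.encard_ne_top_iff.mp fun htop => ?_
  exact hω.ne (by rw [show {e | e ∈ (G ω).E ∧ e.1 1 ≤ h ∧ (h : ℝ) < e.2 1 ∧ crossCell h e = k} =
    {e ∈ (G ω).E | e.1 1 ≤ h ∧ (h : ℝ) < e.2 1 ∧ ⌊cross h e⌋ = k} from rfl, htop]; rfl)

omit [IsFiniteMeasure P] in
-- Mass transport from `Bi` to itself along succession: each such arc has a `Bi` predecessor and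
-- only one successor, and the intensities are trivially equal.
lemma ae_bi_unique (hG : Measurable G)
    (hT : ∀ (s : Plane) (ω : Ω), G (s +ᵥ ω) = (G ω).translate s)
    (hfin : ∫⁻ ω, ((G ω).unitSquareEdgeCount : ENNReal) ∂P < ⊤) (hgood : ∀ᵐ ω ∂P, (G ω).Good) :
    ∀ᵐ ω ∂P, ∀ d e e', (G ω).Bi d → (G ω).Bi e → (G ω).Bi e' → e.2 = d.1 → e'.2 = d.1 →
      e = e' := by
  have h := ae_bijective_of_transport (P := P) (S := Bi) (S' := Bi) (R := fun _ e d => e.2 = d.1)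
    (pos := tailCell) (pos' := tailCell) hG hT (isArcFactor_bi latticePoint)
    (isArcFactor_bi latticePoint)
    (measurableSet_setOfPred.mp (measurableSet_eq_fun measurable_snd.fst.snd
      measurable_snd.snd.fst))
    (fun γ g e d => by simp) isArcLabel_tailCell isArcLabel_tailCell
    (by filter_upwards [hgood] with ω hω d hd using hω.exists_bi_pred hd)
    (by filter_upwards [hgood] with ω hω e d d' _ hd hd' h h'
          using hω.eq_of_fst_eq hd.1 hd'.1 (h.symm.trans h'))
    (fun c => le_rfl)
    (fun c => by
      refine lintegral_arcCount_lt_top hT hfin (latticePoint (-c)) (fun ω e he => he.1.1) ?_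
      rintro ω e ⟨-, rfl⟩
      refine ⟨e.1, left_mem_segment ℝ _ _, fun i => ?_⟩
      fin_cases i
      all_goals
        simp [tailCell]
        constructor
      · linarith [Int.floor_le (e.1 0)]
      · linarith [Int.lt_floor_add_one (e.1 0)]
      · linarith [Int.floor_le (e.1 1)]
      · linarith [Int.lt_floor_add_one (e.1 1)])
  filter_upwards [h] with ω hω d e e' hd he he' h1 h2 using hω.2 d e e' hd he he' h1 h2

omit [MeasurableVAdd₂ Plane Ω] in
-- If there were terminal arcs, some would lie to the left of an exit `d` outside the class of `e`.
-- Such an arc `c` shares its class with `d`, and also with `e` because of whichever of `c` and `e`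
-- lies further left.
lemma ae_not_terminal (hG : Measurable G)
    (hT : ∀ (s : Plane) (ω : Ω), G (s +ᵥ ω) = (G ω).translate s)
    (hgood : ∀ᵐ ω ∂P, (G ω).Good) (h : ℝ) : ∀ᵐ ω ∂P, ∀ e, ¬ (G ω).Terminal 1 h e := by
  filter_upwards [hgood, ae_exists_lt (P := P) hG hT (isArcFactor_terminal 1 h)
    (isArcLabel_crossCell h)] with ω hω hlt e he
  obtain ⟨d, hdE, hd, hed⟩ := he.2.2
  obtain ⟨c, hc, hcd⟩ := hlt ⟨e, he⟩ (crossCell h d)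
  have hcd' : cross h c < cross h d := by
    by_contra! hle
    exact absurd (Int.floor_mono hle) (not_le.mpr hcd)
  have h1 := hc.2.1 d hdE hd (by linarith)
  rcases le_total (cross h c) (cross h e) with hce | hce
  · have h2 := hc.2.1 e he.1.1 he.1 (by linarith)
    exact hed (hω.same_trans he.1.1 hc.1.1 hdE h2.symm h1)
  · have h2 := he.2.1 c hc.1.1 hc.1 (by linarith)
    exact hed (hω.same_trans he.1.1 hc.1.1 hdE h2 h1)

omit [MeasurableVAdd₂ Plane Ω] in
lemma ae_not_terminal_neg (hG : Measurable G)
    (hT : ∀ (s : Plane) (ω : Ω), G (s +ᵥ ω) = (G ω).translate s)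
    (hgood : ∀ᵐ ω ∂P, (G ω).Good) (h : ℝ) : ∀ᵐ ω ∂P, ∀ e, ¬ (G ω).Terminal (-1) h e := by
  filter_upwards [hgood, ae_exists_gt (P := P) hG hT (isArcFactor_terminal (-1) h)
    (isArcLabel_crossCell h)] with ω hω hlt e he
  obtain ⟨d, hdE, hd, hed⟩ := he.2.2
  obtain ⟨c, hc, hcd⟩ := hlt ⟨e, he⟩ (crossCell h d)
  have hcd' : cross h d < cross h c := by
    by_contra! hle
    exact absurd (Int.floor_mono hle) (not_le.mpr hcd)
  have h1 := hc.2.1 d hdE hd (by linarith)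
  rcases le_total (cross h e) (cross h c) with hce | hce
  · have h2 := hc.2.1 e he.1.1 he.1 (by linarith)
    exact hed (hω.same_trans he.1.1 hc.1.1 hdE h2.symm h1)
  · have h2 := he.2.1 c hc.1.1 hc.1 (by linarith)
    exact hed (hω.same_trans he.1.1 hc.1.1 hdE h2 h1)

/-- Orbits climb, so every class with an exit at level `h` has one at level `h + 1`. The transport
goes from the upper level to the lower one; equal intensities then leave no upper rightmost exit
without a partner. -/
lemma ae_exists_rightmost_below (hG : Measurable G)
    (hT : ∀ (s : Plane) (ω : Ω), G (s +ᵥ ω) = (G ω).translate s)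
    (hfin : ∫⁻ ω, ((G ω).unitSquareEdgeCount : ENNReal) ∂P < ⊤) (hgood : ∀ᵐ ω ∂P, (G ω).Good)
    (h : ℤ) : ∀ᵐ ω ∂P, ∀ e, (G ω).Rightmost (h + 1 : ℤ) e →
      ∃ d, (G ω).Rightmost h d ∧ (G ω).Same e d := by
  have hmain := ae_bijective_of_transport (P := P) (S := fun g => g.Rightmost (h + 1 : ℤ))
    (S' := fun g => g.Rightmost h) (R := Same)
    (pos := crossCell (h + 1 : ℤ)) (pos' := crossCell h) hG hT (isArcFactor_rightmost _)
    (isArcFactor_rightmost _) (measurable_same measurable_fst measurable_snd.fst measurable_snd.snd)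
    (fun γ g e d => same_translate g _) (isArcLabel_crossCell _) (isArcLabel_crossCell _)
    ?_ ?_ ?_ ?_
  · filter_upwards [hmain] with ω hω e he using hω.1 e he
  · filter_upwards [hgood, ae_not_terminal hG hT hgood (h + 1 : ℤ),
      ae_not_terminal_neg hG hT hgood (h + 1 : ℤ),
      ae_exists_gt (P := P) hG hT (isArcFactor_exit h) (isArcLabel_crossCell h)]
      with ω hω hR hL hgt d hd
    -- Exits to the right of a rightmost exit belong to another class. This second class is what
    -- forces the class of `d` to be finite one level up.
    obtain ⟨c, hc, hdc⟩ := hgt ⟨d, hd.1⟩ (crossCell h d)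
    have hdc' : cross h d < cross h c := by
      by_contra! hle
      exact absurd (Int.floor_mono hle) (not_le.mpr hdc)
    have hns : ¬ (G ω).Same d c := fun hs => absurd (hd.2 c hc.1 hc hs) (not_le.mpr hdc')
    have hlev : ∀ {a : Arc}, (G ω).Exit h a → a.1 1 ≤ ((h + 1 : ℤ) : ℝ) := by
      intro a ha
      have := ha.2.1
      push_cast
      linarith
    obtain ⟨m, hm⟩ := hω.exists_exit hd.1.1 (hlev hd.1)
    obtain ⟨n, hn⟩ := hω.exists_exit hc.1 (hlev hc)
    have hdm := hω.same_iterate hd.1.1 m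
    have hcn := hω.same_iterate hc.1 n
    obtain ⟨b, hb, hbs⟩ := hω.exists_rightmost hR hL hm hn fun hs => hns
      (hω.same_trans hd.1.1 hm.1 hc.1 hdm (hω.same_trans hm.1 hn.1 hc.1 hs hcn.symm))
    exact ⟨b, hb, (hω.same_trans hd.1.1 hm.1 hb.1.1 hdm hbs).symm⟩
  · filter_upwards [hgood] with ω hω e d d' he hd hd' h1 h2
    exact hω.rightmost_unique hd hd' (hω.same_trans hd.1.1 he.1.1 hd'.1.1 h1.symm h2)
  · intro c
    -- The vertical unit translation carries rightmost exits at level `h` to those at level `h + 1`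
    -- without moving their abscissas.
    rw [← lintegral_vadd (latticePoint (0, 1))]
    refine lintegral_mono fun ω => ?_
    rw [← arcCount_comp (latticePoint (0, 1))]
    refine le_of_eq (congrArg arcCount (funext fun e => ?_))
    have hlev : ((h + 1 : ℤ) : ℝ) = (h : ℝ) + latticePoint (0, 1) 1 := by simp
    rw [hT, hlev, rightmost_translate, crossCell, cross_shiftArc]
    simp [crossCell]
  · intro c
    refine (lintegral_mono fun ω => ?_).trans_lt (lintegral_cross_lt_top hT hfin h c)
    simp only [arcCount_eq_encard]
    refine ENat.toENNReal_le.mpr (Set.encard_le_encard ?_)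
    rintro e ⟨he, hec⟩
    exact ⟨he.1.1, he.1.2.1, he.1.2.2 e he.1.1 ⟨0, rfl⟩, hec⟩

theorem ae_generic (hG : Measurable G)
    (hT : ∀ (s : Plane) (ω : Ω), G (s +ᵥ ω) = (G ω).translate s)
    (hfin : ∫⁻ ω, ((G ω).unitSquareEdgeCount : ENNReal) ∂P < ⊤) (hgood : ∀ᵐ ω ∂P, (G ω).Good) :
    ∀ᵐ ω ∂P, (G ω).Generic := by
  have hbiexit : ∀ h : ℝ, IsArcFactor horizontal fun g e => g.Exit h e ∧ g.Bi e := fun h =>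
    ⟨fun g e he => he.2.1, (isArcFactor_exit h).measurable.and (isArcFactor_bi horizontal).measurable,
      fun k g e => by rw [exit_horizontal, bi_translate]⟩
  filter_upwards [hgood,
    ae_all_iff.mpr fun h : ℤ => ae_exists_lt (P := P) hG hT (isArcFactor_exit h)
      (isArcLabel_crossCell h),
    ae_all_iff.mpr fun h : ℤ => ae_not_terminal hG hT hgood h,
    ae_all_iff.mpr fun h : ℤ => ae_not_terminal_neg hG hT hgood h,
    ae_bi_unique hG hT hfin hgood,
    ae_all_iff.mpr fun h : ℤ => ae_exists_lt (P := P) hG hT (hbiexit h)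
      (isArcLabel_crossCell h),
    ae_all_iff.mpr fun h : ℤ => ae_exists_rightmost_below hG hT hfin hgood h]
    with ω h1 h2 h3 h4 h5 h6 h7
  exact ⟨h1, h2, h3, h4, h5, h6, h7⟩

end Stationary

end GeomGraph

/-! ### Ends of the graph of a map with injective orbits -/

namespace SimpleGraph.ConnectedComponent

variable {W : Type*} {H : SimpleGraph W} {f : W → W}

lemma SimpleRay.symmDiff_finite {C : H.ConnectedComponent} (p q : C.SimpleRay) {a b : ℕ}
    (h : ∀ k, p.path (a + k) = q.path (b + k)) :
    (symmDiff (Set.range p.path) (Set.range q.path)).Finite := by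
  rw [Set.symmDiff_def]
  refine (((Set.finite_lt_nat a).image p.path).union ((Set.finite_lt_nat b).image q.path)).subset ?_
  rintro _ (⟨⟨i, rfl⟩, hi⟩ | ⟨⟨i, rfl⟩, hi⟩)
  · refine Or.inl ⟨i, ?_, rfl⟩
    by_contra hle
    obtain ⟨k, rfl⟩ := Nat.exists_eq_add_of_le (not_lt.mp hle)
    exact hi ⟨b + k, (h k).symm⟩
  · refine Or.inr ⟨i, ?_, rfl⟩
    by_contra hle
    obtain ⟨k, rfl⟩ := Nat.exists_eq_add_of_le (not_lt.mp hle)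
    exact hi ⟨a + k, h k⟩

/-- The edges of `H` are the pairs `{v, f v}`, and the orbits of `f` are injective. -/
structure _root_.SimpleGraph.IsOrbitGraph (H : SimpleGraph W) (f : W → W) : Prop where
  adj_iff : ∀ u v, H.Adj u v ↔ f u = v ∨ f v = u
  injective : ∀ v, Function.Injective fun n => f^[n] v

variable (hH : H.IsOrbitGraph f)

include hH

lemma _root_.SimpleGraph.IsOrbitGraph.reachable_iterate (v : W) (n : ℕ) :
    H.Reachable v (f^[n] v) := by
  induction n with
  | zero => rfl
  | succ n ih =>
    rw [Function.iterate_succ_apply']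
    exact ih.trans ((hH.adj_iff _ _).mpr (Or.inl rfl)).reachable

lemma _root_.SimpleGraph.IsOrbitGraph.reachable_iff {u v : W} :
    H.Reachable u v ↔ ∃ m n, f^[m] u = f^[n] v := by
  constructor
  · rintro ⟨w⟩
    induction w with
    | nil => exact ⟨0, 0, rfl⟩
    | @cons u w v huw p ih =>
      obtain ⟨m, n, h⟩ := ih
      rcases (hH.adj_iff _ _).mp huw with rfl | rfl
      · exact ⟨m + 1, n, h⟩
      · refine ⟨m, n + 1, ?_⟩
        rw [Function.iterate_succ_apply', ← h, ← Function.iterate_succ_apply' f,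
          Function.iterate_succ_apply]
  · rintro ⟨m, n, h⟩
    exact (hH.reachable_iterate u m).trans (h ▸ (hH.reachable_iterate v n).symm)

/-- Once a ray has taken a step against `f`, a step along `f` would bring it back to the vertex just
left, so it goes against `f` forever. -/
lemma SimpleRay.forward_or_backward {C : H.ConnectedComponent} (p : C.SimpleRay) :
    (∀ n, p.path n = f^[n] (p.path 0)) ∨ ∃ N, ∀ k, f (p.path (N + (k + 1))) = p.path (N + k) := by
  by_cases hd : ∃ N, f (p.path (N + 1)) = p.path N
  · obtain ⟨N, hN⟩ := hd
    refine Or.inr ⟨N, fun k => ?_⟩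
    induction k with
    | zero => exact hN
    | succ k ih =>
      rcases (hH.adj_iff _ _).mp (p.adj (N + (k + 1))) with h | h
      · rw [ih] at h
        have := p.injective h
        omega
      · exact h
  · push Not at hd
    left
    intro n
    induction n with
    | zero => rfl
    | succ n ih =>
      rw [Function.iterate_succ_apply', ← ih]
      exact (((hH.adj_iff _ _).mp (p.adj n)).resolve_right (hd n)).symm

/-- The ray `v, f v, f (f v), …`. -/
def forwardRay (v : W) : (H.connectedComponentMk v).SimpleRay where
  path n := f^[n] v
  injective := hH.injective v
  adj n := by
    rw [Function.iterate_succ_apply']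
    exact (hH.adj_iff _ _).mpr (Or.inl rfl)
  mem n := ConnectedComponent.sound (hH.reachable_iterate v n).symm

omit hH in
lemma iterate_backward {q : ℕ → W} (hq : ∀ n, f (q (n + 1)) = q n) (a n : ℕ) :
    f^[n] (q (a + n)) = q a := by
  induction n with
  | zero => rfl
  | succ n ih => rw [Function.iterate_succ_apply, ← add_assoc, hq, ih]

/-- The ray given by a backward orbit of `f`. -/
def backwardRay (q : ℕ → W) (hq : ∀ n, f (q (n + 1)) = q n) :
    (H.connectedComponentMk (q 0)).SimpleRay where
  path := q
  injective := by
    have key : ∀ a n, q a = q (a + n) → n = 0 := by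
      intro a n h
      have h1 := iterate_backward hq a n
      rw [← h] at h1
      exact hH.injective (q a) h1
    intro a b h
    rcases le_total a b with hab | hab
    · obtain ⟨n, rfl⟩ := Nat.exists_eq_add_of_le hab
      rw [key a n h, add_zero]
    · obtain ⟨n, rfl⟩ := Nat.exists_eq_add_of_le hab
      rw [key b n h.symm, add_zero]
  adj n := (hH.adj_iff _ _).mpr (Or.inr (hq n))
  mem n := by
    have := hH.reachable_iterate (q n) n
    have h2 := iterate_backward hq 0 n
    rw [zero_add] at h2
    rw [h2] at this
    exact ConnectedComponent.sound this

lemma SimpleRay.forward_equiv {C : H.ConnectedComponent} {p q : C.SimpleRay}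
    (hp : ∀ n, p.path n = f^[n] (p.path 0)) (hq : ∀ n, q.path n = f^[n] (q.path 0)) :
    (symmDiff (Set.range p.path) (Set.range q.path)).Finite := by
  obtain ⟨m, n, h⟩ := hH.reachable_iff.mp
    (ConnectedComponent.exact ((p.mem 0).trans (q.mem 0).symm))
  refine p.symmDiff_finite q (a := m) (b := n) fun k => ?_
  rw [hp, hq, add_comm, Function.iterate_add_apply, h, ← Function.iterate_add_apply, add_comm]

/-- If the forward ray at time `n` meets the backward one at `N + a`, then `a` further applications
of `f` lead to `q.path N`. Injectivity of the orbit fixes `a + n`, which bounds the meeting times.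
-/
lemma SimpleRay.not_forward_equiv_backward {C : H.ConnectedComponent} {p q : C.SimpleRay}
    (hp : ∀ n, p.path n = f^[n] (p.path 0)) {N : ℕ}
    (hq : ∀ k, f (q.path (N + (k + 1))) = q.path (N + k)) :
    ¬ (symmDiff (Set.range p.path) (Set.range q.path)).Finite := by
  intro hfin
  rw [Set.symmDiff_def] at hfin
  have h1 : {n | p.path n ∉ Set.range q.path}.Finite :=
    ((hfin.subset Set.subset_union_left).preimage p.injective.injOn).subset
      fun n hn => ⟨⟨n, rfl⟩, hn⟩
  have h2 : {n | p.path n ∈ q.path '' {i | i < N}}.Finite :=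
    ((Set.finite_lt_nat N).image q.path).preimage p.injective.injOn
  have h3 : ∀ᶠ n in atTop, ∃ a, p.path n = q.path (N + a) := by
    rw [← Nat.cofinite_eq_atTop, eventually_cofinite]
    refine (h1.union h2).subset fun n hn => ?_
    by_contra hno
    simp only [Set.mem_union, not_or] at hno
    obtain ⟨i, hi⟩ := not_not.mp hno.1
    rcases Nat.lt_or_ge i N with hiN | hiN
    · exact hno.2 ⟨i, hiN, hi⟩
    · obtain ⟨a, rfl⟩ := Nat.exists_eq_add_of_le hiN
      exact hn ⟨a, hi.symm⟩
  have h4 : ∀ n a, p.path n = q.path (N + a) → f^[a + n] (p.path 0) = q.path N := by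
    intro n a h
    rw [Function.iterate_add_apply, ← hp, h]
    exact iterate_backward (q := fun k => q.path (N + k)) hq 0 a |>.symm ▸ by simp
  obtain ⟨n₁, a₁, h₁⟩ := h3.exists
  obtain ⟨n₂, ⟨a₂, h₂⟩, hn⟩ := (h3.and (eventually_gt_atTop (a₁ + n₁))).exists
  have := hH.injective (p.path 0) ((h4 _ _ h₁).trans (h4 _ _ h₂).symm)
  omega

/-- Without backward orbits every ray is forward, and forward rays in one component merge. -/
theorem numEnds_eq_one (C : H.ConnectedComponent)
    (hC : ∀ q : ℕ → W, q 0 ∈ C.supp → ¬ ∀ n, f (q (n + 1)) = q n) : C.numEnds = 1 := by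
  obtain ⟨v, rfl⟩ := C.exists_rep
  have hfwd : ∀ p : (H.connectedComponentMk v).SimpleRay, ∀ n, p.path n = f^[n] (p.path 0) := by
    intro p
    refine (p.forward_or_backward hH).resolve_right ?_
    rintro ⟨N, hN⟩
    exact hC (fun k => p.path (N + k)) (p.mem N) hN
  have h1 : Nonempty (Quotient (coalescence (H.connectedComponentMk v))) :=
    ⟨Quotient.mk _ (forwardRay hH v)⟩
  have h2 : Subsingleton (Quotient (coalescence (H.connectedComponentMk v))) := by
    refine ⟨fun a b => ?_⟩
    induction a using Quotient.inductionOn with | _ p =>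
    induction b using Quotient.inductionOn with | _ q =>
    exact Quotient.sound (SimpleRay.forward_equiv hH (hfwd p) (hfwd q))
  exact ENat.card_eq_one_iff_unique.mpr ((unique_iff_subsingleton_and_nonempty _).mpr ⟨h2, h1⟩)

/-- One end is the common end of all forward rays; by `huniq` the eventually backward rays have only
one other. -/
theorem numEnds_eq_two (C : H.ConnectedComponent) (q : ℕ → W) (hq0 : q 0 ∈ C.supp)
    (hq : ∀ n, f (q (n + 1)) = q n)
    (huniq : ∀ r s : ℕ → W, r 0 ∈ C.supp → s 0 ∈ C.supp → (∀ n, f (r (n + 1)) = r n) →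
      (∀ n, f (s (n + 1)) = s n) → ∃ a b, ∀ k, r (a + k) = s (b + k)) : C.numEnds = 2 := by
  obtain rfl : H.connectedComponentMk (q 0) = C := hq0
  set C := H.connectedComponentMk (q 0)
  have hne : (Quotient.mk (coalescence C) (forwardRay hH (q 0))) ≠
      Quotient.mk (coalescence C) (backwardRay hH q hq) := by
    intro h
    exact SimpleRay.not_forward_equiv_backward hH (N := 0) (p := forwardRay hH (q 0))
      (q := backwardRay hH q hq) (fun n => rfl)
      (fun k => by simpa [backwardRay] using hq k) (Quotient.exact h)
  have huniv : (Set.univ : Set (Quotient (coalescence C))) =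
      {Quotient.mk (coalescence C) (forwardRay hH (q 0)),
        Quotient.mk (coalescence C) (backwardRay hH q hq)} := by
    refine (Set.eq_univ_of_forall fun x => ?_).symm
    induction x using Quotient.inductionOn with | _ p =>
    rcases p.forward_or_backward hH with hp | ⟨N, hN⟩
    · exact Or.inl (Quotient.sound (SimpleRay.forward_equiv hH hp fun n => rfl))
    · right
      obtain ⟨a, b, hab⟩ := huniq (fun k => p.path (N + k)) q (p.mem N) rfl hN hq
      exact Quotient.sound (p.symmDiff_finite (backwardRay hH q hq) (a := N + a) (b := b)
        fun k => by rw [add_assoc]; exact hab k)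
  rw [numEnds, ← Set.encard_univ, huniv, Set.encard_pair hne]

end SimpleGraph.ConnectedComponent

/-! ### From classes of arcs to components and their ends -/

namespace GeomGraph

namespace Good

variable {g : GeomGraph} (hg : g.Good) {e d : Arc}

include hg

/-- The arc with tail `v`. -/
noncomputable def outArc (v : g.V) : Arc := (hg.exists_fst_eq v.2).choose

lemma outArc_mem (v : g.V) : hg.outArc v ∈ g.E := (hg.exists_fst_eq v.2).choose_spec.1

lemma outArc_fst (v : g.V) : (hg.outArc v).1 = v := (hg.exists_fst_eq v.2).choose_spec.2

lemma outArc_eq (he : e ∈ g.E) : hg.outArc ⟨e.1, (g.edge_mem e he).1⟩ = e :=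
  hg.eq_of_fst_eq (hg.outArc_mem _) he (hg.outArc_fst _)

lemma outArc_injective : Function.Injective hg.outArc := by
  intro u v h
  exact Subtype.ext (by rw [← hg.outArc_fst u, h, hg.outArc_fst])

/-- The head of the arc with tail `v`. -/
noncomputable def parent (v : g.V) : g.V := ⟨(hg.outArc v).2, (g.edge_mem _ (hg.outArc_mem v)).2⟩

lemma outArc_parent (v : g.V) : hg.outArc (hg.parent v) = g.succ (hg.outArc v) :=
  ((hg.succ_eq_iff (hg.outArc_mem v) (hg.outArc_mem _)).mpr (hg.outArc_fst (hg.parent v))).symm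

lemma outArc_iterate (v : g.V) (n : ℕ) :
    hg.outArc (hg.parent^[n] v) = g.succ^[n] (hg.outArc v) := by
  induction n with
  | zero => rfl
  | succ n ih => rw [Function.iterate_succ_apply', outArc_parent, ih, Function.iterate_succ_apply']

lemma parent_eq_iff (u v : g.V) : hg.parent u = v ↔ ((u : Plane), (v : Plane)) ∈ g.E := by
  have h1 := hg.outArc_mem u
  have h2 := hg.outArc_fst u
  constructor
  · rintro rfl
    rw [← h2]
    exact h1
  · intro h
    refine Subtype.ext ?_
    exact congrArg Prod.snd (hg.eq_of_fst_eq h1 h h2)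

lemma isOrbitGraph : g.graph.IsOrbitGraph hg.parent where
  adj_iff u v := by
    rw [graph, SimpleGraph.fromRel_adj, parent_eq_iff, parent_eq_iff]
    refine and_iff_right_of_imp ?_
    rintro h rfl
    exact g.edge_ne _ (h.elim id id) rfl
  injective v := by
    intro m n h
    have h' := congrArg hg.outArc h
    simp only [outArc_iterate] at h'
    exact hg.iterate_injective (hg.outArc_mem v) h'

/-- This transfers the results on classes of arcs to connected components. -/
lemma reachable_iff {u v : g.V} :
    g.graph.Reachable u v ↔ g.Same (hg.outArc u) (hg.outArc v) := by
  rw [hg.isOrbitGraph.reachable_iff, hg.same_iff (hg.outArc_mem u) (hg.outArc_mem v)]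
  simp only [← outArc_iterate, hg.outArc_injective.eq_iff]

lemma isTree (C : g.graph.ConnectedComponent) : C.toSimpleGraph.IsTree :=
  ⟨C.connected_toSimpleGraph, hg.acyclic.induce _⟩

lemma bi_succ (he : g.Bi e) : g.Bi (g.succ e) := by
  refine ⟨(hg.succ_spec he.1).1, fun n => ?_⟩
  obtain ⟨d, hd, hn⟩ := he.2 n
  refine ⟨g.succ d, (hg.succ_spec hd).1, (hg.iter_iff (hg.succ_spec hd).1).mpr ?_⟩
  rw [← Function.iterate_succ_apply, Function.iterate_succ_apply', (hg.iter_iff hd).mp hn]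

lemma bi_iterate (he : g.Bi e) (n : ℕ) : g.Bi (g.succ^[n] e) := by
  induction n with
  | zero => exact he
  | succ n ih => rw [Function.iterate_succ_apply']; exact hg.bi_succ ih

lemma bi_of_backward {q : ℕ → g.V} (hq : ∀ n, hg.parent (q (n + 1)) = q n) (a : ℕ) :
    g.Bi (hg.outArc (q a)) := by
  refine ⟨hg.outArc_mem _, fun n => ⟨hg.outArc (q (a + n)), hg.outArc_mem _, ?_⟩⟩
  rw [hg.iter_iff (hg.outArc_mem _), ← outArc_iterate,
    SimpleGraph.ConnectedComponent.iterate_backward hq a n]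

lemma exists_backward (he : g.Bi e) :
    ∃ q : ℕ → g.V, hg.outArc (q 0) = e ∧ ∀ n, hg.parent (q (n + 1)) = q n := by
  have h : ∀ v : {v : g.V // g.Bi (hg.outArc v)}, ∃ w : {v : g.V // g.Bi (hg.outArc v)},
      hg.parent w.1 = v.1 := by
    rintro ⟨v, hv⟩
    obtain ⟨c, hc, hcv⟩ := hg.exists_bi_pred hv
    refine ⟨⟨⟨c.1, (g.edge_mem c hc.1).1⟩, by rwa [hg.outArc_eq hc.1]⟩, ?_⟩
    rw [parent_eq_iff]
    rw [hg.outArc_fst] at hcv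
    simpa only [← hcv] using hc.1
  choose pred hpred using h
  set v₀ : {v : g.V // g.Bi (hg.outArc v)} :=
    ⟨⟨e.1, (g.edge_mem e he.1).1⟩, by rwa [hg.outArc_eq he.1]⟩
  refine ⟨fun n => (pred^[n] v₀).1, hg.outArc_eq he.1, fun n => ?_⟩
  show hg.parent (pred^[n + 1] v₀).1 = (pred^[n] v₀).1
  rw [Function.iterate_succ_apply']
  exact hpred _

lemma finite_preimage_iterate (d : Arc) (n : ℕ) : {e ∈ g.E | g.succ^[n] e = d}.Finite := by
  induction n with
  | zero => exact (Set.finite_singleton d).subset fun e he => he.2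
  | succ n ih =>
    refine (ih.biUnion fun c _ => hg.finite_pred c.1).subset ?_
    rintro e ⟨he, hed⟩
    exact Set.mem_biUnion (x := g.succ e) ⟨(hg.succ_spec he).1, hed⟩
      ⟨he, (hg.succ_spec he).2.symm⟩

/-- An arc with arbitrarily low ancestors has ancestors of every generation. -/
lemma bi_of_frequently_low {x : Arc} (hx : x ∈ g.E) (h : ℝ)
    (hlow : ∃ᶠ n : ℕ in atTop, ∃ r ∈ g.E, ∃ k, g.succ^[k] r = x ∧ r.1 1 ≤ h - n) : g.Bi x := by
  refine ⟨hx, fun N => ?_⟩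
  have hfin : {e | ∃ k < N, e ∈ g.E ∧ g.succ^[k] e = x}.Finite := by
    have : {e | ∃ k < N, e ∈ g.E ∧ g.succ^[k] e = x} =
        ⋃ k ∈ {k | k < N}, {e ∈ g.E | g.succ^[k] e = x} := by
      ext e
      simp only [Set.mem_iUnion, Set.mem_ofPred_eq, exists_prop]
    rw [this]
    exact (Set.finite_lt_nat N).biUnion fun k _ => hg.finite_preimage_iterate x k
  -- The finitely many ancestors of fewer than `N` generations have tails above some height `b`; an
  -- ancestor below `b` is at least `N` generations old.
  obtain ⟨b, hb⟩ := (hfin.image fun e => e.1 1).bddBelow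
  obtain ⟨M, hM⟩ := exists_nat_gt (h - b)
  obtain ⟨n, hn, r, hr, k, hk, hrn⟩ := (frequently_atTop.mp hlow) M
  have hNk : N ≤ k := by
    by_contra! hlt
    have h1 := hb ⟨r, ⟨k, hlt, hr, hk⟩, rfl⟩
    have h2 : (M : ℝ) ≤ n := by exact_mod_cast hn
    simp only at h1
    linarith
  refine ⟨g.succ^[k - N] r, hg.iterate_mem hr _, (hg.iter_iff (hg.iterate_mem hr _)).mpr ?_⟩
  rw [← Function.iterate_add_apply, Nat.add_sub_cancel' hNk, hk]

end Good

namespace Generic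

variable {g : GeomGraph} (hg : g.Generic) {e d : Arc}

include hg

/-- Uniqueness of the `Bi` predecessor makes the successor map injective on `Bi` arcs. -/
lemma bi_injective (k : ℕ) : ∀ {a b : Arc}, g.Bi a → g.Bi b → g.succ^[k] a = g.succ^[k] b →
    a = b := by
  induction k with
  | zero => exact fun _ _ h => h
  | succ k ih =>
    intro a b ha hb h
    have h1 := ih (hg.bi_succ ha) (hg.bi_succ hb) h
    refine hg.bi_unique (g.succ a) a b (hg.bi_succ ha) ha hb (hg.succ_spec ha.1).2.symm ?_
    rw [h1]
    exact (hg.succ_spec hb.1).2.symm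

lemma bi_linear (he : g.Bi e) (hd : g.Bi d) (hs : g.Same e d) :
    ∃ k, g.succ^[k] e = d ∨ g.succ^[k] d = e := by
  obtain ⟨m, n, h⟩ := (hg.same_iff he.1 hd.1).mp hs
  rcases le_total m n with hmn | hmn
  · obtain ⟨k, rfl⟩ := Nat.exists_eq_add_of_le hmn
    rw [Function.iterate_add_apply] at h
    exact ⟨k, Or.inr (hg.bi_injective m he (hg.bi_iterate hd k) h).symm⟩
  · obtain ⟨k, rfl⟩ := Nat.exists_eq_add_of_le hmn
    rw [Function.iterate_add_apply] at h
    exact ⟨k, Or.inl (hg.bi_injective n (hg.bi_iterate he k) hd h)⟩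

/-- If all arcs are in one class, the `Bi` arcs lie on one path, which exits a level only once,
while stationarity spreads `Bi` exits arbitrarily far to the left. -/
lemma not_bi (hall : ∀ e ∈ g.E, ∀ d ∈ g.E, g.Same e d) (e : Arc) : ¬ g.Bi e := by
  intro he
  obtain ⟨n, hn⟩ := hg.exists_exit he.1 (Int.le_ceil (e.1 1))
  set h : ℤ := ⌈e.1 1⌉
  set a := g.succ^[n] e
  have ha : g.Bi a := hg.bi_iterate he n
  obtain ⟨b, ⟨hbx, hb⟩, hlt⟩ := hg.exists_bi_lt h ⟨a, hn, ha⟩ (crossCell h a)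
  -- After an exit all later tails are above the level.
  have key : ∀ {x y : Arc}, g.Exit h x → g.Exit h y → ∀ k, g.succ^[k] x = y → x = y := by
    intro x y hx hy k hk
    cases k with
    | zero => exact hk
    | succ k =>
      have h1 := (hg.exit_iff.mp hx).2.2 k
      rw [← hg.iterate_succ_fst hx.1, hk] at h1
      exact absurd hy.2.1 (not_le.mpr h1)
  have hab : a = b := by
    obtain ⟨k, hk | hk⟩ := hg.bi_linear ha hb (hall a ha.1 b hb.1)
    · exact key hn hbx k hk
    · exact (key hbx hn k hk).symm
  rw [hab] at hlt
  exact lt_irrefl _ hlt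

lemma finite_class' {h : ℤ} (he : g.Exit h e) (hd : g.Exit h d) (hed : ¬ g.Same e d) :
    {c | g.Exit h c ∧ g.Same e c}.Finite :=
  hg.finite_class (hg.not_terminal h) (hg.not_terminal_neg h) he hd hed

/-- If there are several classes, then each of them contains a bi-infinite path. -/
lemma exists_bi_same (he : e ∈ g.E) (hd : d ∈ g.E) (hed : ¬ g.Same e d) :
    ∃ x, g.Bi x ∧ g.Same e x := by
  set h : ℤ := max ⌈e.1 1⌉ ⌈d.1 1⌉
  have hhe : e.1 1 ≤ h := (Int.le_ceil _).trans (Int.cast_le.mpr (le_max_left _ _))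
  have hhd : d.1 1 ≤ h := (Int.le_ceil _).trans (Int.cast_le.mpr (le_max_right _ _))
  obtain ⟨m, hm⟩ := hg.exists_exit he hhe
  obtain ⟨n, hn⟩ := hg.exists_exit hd hhd
  have hem := hg.same_iterate he m
  have hdn := hg.same_iterate hd n
  have hns : ¬ g.Same (g.succ^[m] e) (g.succ^[n] d) := fun hs =>
    hed (hg.same_trans he hm.1 hd hem (hg.same_trans hm.1 hn.1 hd hs hdn.symm))
  -- The class is followed downwards one level at a time through its rightmost exits.
  have hdesc : ∀ j : ℕ, ∃ r, g.Rightmost (h - j : ℤ) r ∧ g.Same e r := by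
    intro j
    induction j with
    | zero =>
      obtain ⟨c, hc, hec⟩ := hg.exists_rightmost (hg.not_terminal h) (hg.not_terminal_neg h)
        hm hn hns
      refine ⟨c, by simpa using hc, hg.same_trans he hm.1 hc.1.1 hem hec⟩
    | succ j ih =>
      obtain ⟨r, hr, her⟩ := ih
      obtain ⟨c, hc, hrc⟩ := hg.exists_rightmost_below (h - (j + 1 : ℕ)) r (by
        rwa [show h - ((j + 1 : ℕ) : ℤ) + 1 = h - j by push_cast; ring])
      exact ⟨c, hc, hg.same_trans he hr.1.1 hc.1.1 her hrc⟩
  -- Each low arc climbs back to one of the finitely many exits of the class at level `h`; some exit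
  -- is reached from infinitely many depths.
  have hstep : ∀ j : ℕ, ∃ x ∈ {c | g.Exit h c ∧ g.Same (g.succ^[m] e) c},
      ∃ r ∈ g.E, ∃ k, g.succ^[k] r = x ∧ r.1 1 ≤ (h : ℝ) - j := by
    intro j
    obtain ⟨r, hr, her⟩ := hdesc j
    have hrj : r.1 1 ≤ (h : ℝ) - j := by
      have := hr.1.2.1
      push_cast at this
      exact this
    have hj : (0 : ℝ) ≤ j := Nat.cast_nonneg j
    obtain ⟨k, hk⟩ := hg.exists_exit (h := h) hr.1.1 (by linarith)
    refine ⟨g.succ^[k] r, ⟨hk, ?_⟩, r, hr.1.1, k, rfl, hrj⟩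
    exact hg.same_trans hm.1 he hk.1 hem.symm
      (hg.same_trans he hr.1.1 hk.1 her (hg.same_iterate hr.1.1 k))
  choose x hx hxr using hstep
  have hfin := hg.finite_class' hm hn hns
  obtain ⟨y, hy, hfreq⟩ : ∃ y ∈ {c | g.Exit h c ∧ g.Same (g.succ^[m] e) c},
      ∃ᶠ j in atTop, x j = y := by
    by_contra! hno
    have hev : ∀ᶠ j in atTop, ∀ y ∈ {c | g.Exit h c ∧ g.Same (g.succ^[m] e) c}, x j ≠ y :=
      (eventually_all_finite hfin).mpr fun y hy => by simpa using hno y hy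
    obtain ⟨j, hj⟩ := hev.exists
    exact hj _ (hx j) rfl
  refine ⟨y, hg.bi_of_frequently_low hy.1.1 h (hfreq.mono ?_), hg.same_trans he hm.1 hy.1.1 hem hy.2⟩
  rintro j rfl
  exact hxr j

theorem isSingleOneEndedTree (hall : ∀ e ∈ g.E, ∀ d ∈ g.E, g.Same e d) :
    g.IsSingleOneEndedTree := by
  have hg' := hg.toGood
  constructor
  · obtain ⟨v, hv⟩ := hg.nonempty
    refine ENat.card_eq_one_iff_unique.mpr
      ((unique_iff_subsingleton_and_nonempty _).mpr ⟨⟨fun C D => ?_⟩,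
        ⟨g.graph.connectedComponentMk ⟨v, hv⟩⟩⟩)
    induction C using SimpleGraph.ConnectedComponent.ind with | _ u =>
    induction D using SimpleGraph.ConnectedComponent.ind with | _ w =>
    exact SimpleGraph.ConnectedComponent.sound
      (hg'.reachable_iff.mpr (hall _ (hg'.outArc_mem u) _ (hg'.outArc_mem w)))
  · refine fun C => ⟨hg'.isTree C, C.numEnds_eq_one hg'.isOrbitGraph fun q _ hq => ?_⟩
    exact hg.not_bi hall _ (hg'.bi_of_backward hq 0)

/-- Finitely many classes, each with finitely many exits at a level, would leave a leftmost cell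
with an exit. -/
lemma infinite_connectedComponent (hnot : ¬ ∀ e ∈ g.E, ∀ d ∈ g.E, g.Same e d) :
    Infinite g.graph.ConnectedComponent := by
  have hg' := hg.toGood
  by_contra hfinite
  rw [not_infinite_iff_finite] at hfinite
  push Not at hnot
  obtain ⟨e₀, he₀, d₀, hd₀, hed₀⟩ := hnot
  set a : g.graph.ConnectedComponent → Arc := fun C => hg'.outArc C.exists_rep.choose with ha
  have haE : ∀ C, a C ∈ g.E := fun C => hg'.outArc_mem _
  have hrep : ∀ e ∈ g.E, ∃ C, g.Same e (a C) := by
    intro e he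
    refine ⟨g.graph.connectedComponentMk ⟨e.1, (g.edge_mem e he).1⟩, ?_⟩
    set C := g.graph.connectedComponentMk ⟨e.1, (g.edge_mem e he).1⟩ with hC
    have h1 : g.graph.connectedComponentMk C.exists_rep.choose = C := C.exists_rep.choose_spec
    have h2 := hg'.reachable_iff.mp (SimpleGraph.ConnectedComponent.exact h1)
    rw [hg'.outArc_eq he] at h2
    exact h2.symm
  -- With finitely many classes, one level can be taken above the tails of a representative of each,
  -- so that every class has an exit there.
  obtain ⟨b, hb⟩ := (Set.finite_range fun C => (a C).1 1).bddAbove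
  set h : ℤ := ⌈b⌉
  have hex : ∀ C, ∃ n, g.Exit h (g.succ^[n] (a C)) := fun C =>
    hg.exists_exit (haE C) ((hb ⟨C, rfl⟩).trans (Int.le_ceil b))
  choose n hn using hex
  have hsame : ∀ C, g.Same (a C) (g.succ^[n C] (a C)) := fun C => hg.same_iterate (haE C) _
  have hrep' : ∀ e ∈ g.E, ∃ C, g.Same e (g.succ^[n C] (a C)) := by
    intro e he
    obtain ⟨C, hC⟩ := hrep e he
    exact ⟨C, hg.same_trans he (haE C) (hn C).1 hC (hsame C)⟩
  obtain ⟨C₁, hC₁⟩ := hrep' e₀ he₀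
  obtain ⟨C₂, hC₂⟩ := hrep' d₀ hd₀
  have hother : ∀ C, ∃ d, g.Exit h d ∧ ¬ g.Same (g.succ^[n C] (a C)) d := by
    intro C
    by_contra! hno
    have h1 := hg.same_trans he₀ (hn C₁).1 (hn C).1 hC₁ (hno _ (hn C₁)).symm
    have h2 := hg.same_trans (hn C).1 (hn C₂).1 hd₀ (hno _ (hn C₂)) hC₂.symm
    exact hed₀ (hg.same_trans he₀ (hn C).1 hd₀ h1 h2)
  have hfin : {c | g.Exit h c}.Finite := by
    refine (Set.finite_iUnion (f := fun C => {c | g.Exit h c ∧ g.Same (g.succ^[n C] (a C)) c})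
      fun C => ?_).subset ?_
    · obtain ⟨d, hd, hs⟩ := hother C
      exact hg.finite_class' (hn C) hd hs
    · intro c hc
      obtain ⟨C, hC⟩ := hrep' c hc.1
      exact Set.mem_iUnion.mpr ⟨C, hc, hC.symm⟩
  obtain ⟨c, hc, hmin⟩ := Set.exists_min_image _ (crossCell h) hfin ⟨_, hn C₁⟩
  obtain ⟨c', hc', hlt⟩ := hg.exists_exit_lt h ⟨c, hc⟩ (crossCell h c)
  exact absurd (hmin c' hc') (not_le.mpr hlt)

theorem isInfinitelyManyTwoEndedTrees (hnot : ¬ ∀ e ∈ g.E, ∀ d ∈ g.E, g.Same e d) :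
    g.IsInfinitelyManyTwoEndedTrees := by
  have hg' := hg.toGood
  have := hg.infinite_connectedComponent hnot
  refine ⟨ENat.card_eq_top_of_infinite, fun C => ⟨hg'.isTree C, ?_⟩⟩
  induction C using SimpleGraph.ConnectedComponent.ind with | _ v =>
  set e := hg'.outArc v
  have he : e ∈ g.E := hg'.outArc_mem v
  obtain ⟨d, hd, hed⟩ : ∃ d ∈ g.E, ¬ g.Same e d := by
    by_contra! hno
    exact hnot fun a ha b hb => hg.same_trans ha he hb (hno a ha).symm (hno b hb)
  obtain ⟨x, hx, hex⟩ := hg.exists_bi_same he hd hed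
  obtain ⟨q, hq0, hq⟩ := hg'.exists_backward hx
  refine SimpleGraph.ConnectedComponent.numEnds_eq_two hg'.isOrbitGraph _ q ?_ hq ?_
  · refine SimpleGraph.ConnectedComponent.sound (hg'.reachable_iff.mpr ?_)
    rw [hq0]
    exact hex.symm
  · intro r s hr0 hs0 hr hs
    have hrs := hg'.reachable_iff.mp (SimpleGraph.ConnectedComponent.exact (hr0.trans hs0.symm))
    -- Two backward orbits in the class start on one bi-infinite path, and injectivity on `Bi` arcs
    -- forces the lower start to continue the other orbit.
    have key : ∀ {r s : ℕ → g.V}, (∀ n, hg'.parent (r (n + 1)) = r n) →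
        (∀ n, hg'.parent (s (n + 1)) = s n) → ∀ k,
        g.succ^[k] (hg'.outArc (r 0)) = hg'.outArc (s 0) → ∀ n, r n = s (k + n) := by
      intro r s hr hs k hk n
      apply hg'.outArc_injective
      refine hg.bi_injective (k + n) (hg'.bi_of_backward hr n) (hg'.bi_of_backward hs (k + n)) ?_
      have h1 := SimpleGraph.ConnectedComponent.iterate_backward hr 0 n
      have h2 := SimpleGraph.ConnectedComponent.iterate_backward hs 0 (k + n)
      rw [zero_add] at h1 h2
      rw [Function.iterate_add_apply, ← hg'.outArc_iterate (r n), h1, hk, ← hg'.outArc_iterate, h2]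
    obtain ⟨k, hk | hk⟩ := hg.bi_linear (hg'.bi_of_backward hr 0) (hg'.bi_of_backward hs 0) hrs
    · exact ⟨0, k, fun n => by rw [zero_add]; exact key hr hs k hk n⟩
    · exact ⟨k, 0, fun n => by rw [zero_add]; exact (key hs hr k hk n).symm⟩

end Generic

end GeomGraph

theorem mainTheorem2 {Ω : Type*} [MeasurableSpace Ω] (P : Measure Ω) [IsProbabilityMeasure P]
    (G : Ω → GeomGraph) (hG : IsPlanarStationaryForest P G)
    (h_oriented : ∀ᵐ ω ∂P, (G ω).Oriented)
    (h_outdegree : ∀ᵐ ω ∂P, (G ω).OutDegreeOne)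
    (h_nonempty : ∀ᵐ ω ∂P, (G ω).V.Nonempty)
    (h_directed : ∀ᵐ ω ∂P, ∀ p : ℕ → Plane, (G ω).IsDirectedPath p →
      Tendsto (fun n => inner ℝ (p n) (EuclideanSpace.single (1 : Fin 2) (1 : ℝ))) atTop atTop) :
    (∀ᵐ ω ∂P, Xor (G ω).IsSingleOneEndedTree (G ω).IsInfinitelyManyTwoEndedTrees) ∧
      ((∀ᵐ ω ∂P, (G ω).IsSingleOneEndedTree) ∨
        (∀ᵐ ω ∂P, (G ω).IsInfinitelyManyTwoEndedTrees)) := by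
  obtain ⟨_, _, herg, hT⟩ := hG.stationary_ergodic
  have hGm := hG.measurable
  have hgood : ∀ᵐ ω ∂P, (G ω).Good := by
    filter_upwards [hG.acyclic, hG.finite_degree, hG.planar, h_oriented, h_outdegree, h_nonempty,
      h_directed, GeomGraph.ae_finite_cross hGm hT hG.finite_edge_intensity]
      with ω h1 h2 h3 h4 h5 h6 h7 h8
    exact ⟨h1, h2, h3, h4, h5, h6,
      fun p hp => by simpa [EuclideanSpace.inner_single_right] using h7 p hp, h8⟩
  have hgen := GeomGraph.ae_generic hGm hT hG.finite_edge_intensity hgood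
  -- The event of a single class is measurable and translation invariant, so ergodicity gives it
  -- probability `0` or `1`.
  set B : Set Ω := {ω | ∀ e ∈ (G ω).E, ∀ d ∈ (G ω).E, (G ω).Same e d} with hB
  have hBm : MeasurableSet B := by
    refine measurableSet_setOfPred.mpr (GeomGraph.measurable_forall_arc hGm
      (GeomGraph.measurable_forall_arc (hGm.comp measurable_fst) ?_))
    exact GeomGraph.measurable_same (hGm.comp measurable_fst.fst) measurable_fst.snd measurable_snd
  have hBinv : ∀ s : Plane, (fun ω => s +ᵥ ω) ⁻¹' B = B := by
    intro s
    ext ω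
    simp only [hB, Set.mem_preimage, Set.mem_ofPred_eq, hT, GeomGraph.forall_mem_translate,
      GeomGraph.same_translate]
  have h1 : ∀ᵐ ω ∂P, ω ∈ B → (G ω).IsSingleOneEndedTree := by
    filter_upwards [hgen] with ω hω h using hω.isSingleOneEndedTree h
  have h2 : ∀ᵐ ω ∂P, ω ∉ B → (G ω).IsInfinitelyManyTwoEndedTrees := by
    filter_upwards [hgen] with ω hω h using hω.isInfinitelyManyTwoEndedTrees h
  constructor
  · filter_upwards [h1, h2] with ω h1 h2
    -- The two alternatives disagree on the number of components.
    have hex : ¬ ((G ω).IsSingleOneEndedTree ∧ (G ω).IsInfinitelyManyTwoEndedTrees) := by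
      rintro ⟨ha, hb⟩
      exact absurd (ha.1.symm.trans hb.1) (by simp)
    by_cases h : ω ∈ B
    · exact Or.inl ⟨h1 h, fun hb => hex ⟨h1 h, hb⟩⟩
    · exact Or.inr ⟨h2 h, fun ha => hex ⟨ha, h2 h⟩⟩
  · rcases eventuallyConst_set.mp (herg.aeconst_of_forall_preimage_vadd_ae_eq hBm
      fun s => (hBinv s).eventuallyEq) with h | h
    · left
      filter_upwards [h, h1] with ω ha hb using hb ha
    · right
      filter_upwards [h, h2] with ω ha hb using hb ha
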